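/- Let $n\ge 2$. Let $t\in\mathbb R$, $x=(x_1,\dots,x_n)\in\mathbb R^n$ be the independent variables and $\psi$ a complex dependent variable. Subscripts denote partial derivatives, with $\partial_\psi,\partial_{\psi^*}$ the Wirtinger derivatives; subscripts $a,b,c$ of functions refer to $x_a,x_b,x_c$; $a,b,c$ run from $1$ to $n$, and summation over repeated indices is understood; $\nabla\psi=(\psi_1,\dots,\psi_n)$, and $^*$ is complex conjugation. The class $\mathscr N$ consists of the equations $$\mathcal L_{GF}:\quad i\psi_t+G\,\psi_{aa}+F=0,$$ where $G$ and $F$ are smooth complex-valued functions of $(t,x,\psi,\psi^*,\nabla\psi,\nabla\psi^*)$ and $G$ vanishes nowhere. Let $U\subseteq\mathbb R\times\mathbb R^n\times\mathbb C$ be an open set of values of $(t,x,\psi)$ whose fibres over the points $(t,x)$ are connected, and let $$\varphi:\quad \tilde t=T(t,x,\psi,\psi^*),\quad \tilde x_a=X^a(t,x,\psi,\psi^*),\quad \tilde\psi=\Psi(t,x,\psi,\psi^*),\quad \tilde\psi^*=\Psi^*(t,x,\psi,\psi^*)$$ be a smooth point transformation on $U$, with $T,X^a$ real-valued, $\Psi$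 complex-valued and $\mathrm dT\wedge\mathrm dX^1\wedge\dots\wedge\mathrm dX^n\wedge\mathrm d\Psi\wedge\mathrm d\Psi^*\ne0$ on $U$. Let $\mathcal L_{GF}$ and $\mathcal L_{\tilde G\tilde F}$ be equations of the class $\mathscr N$, with $(t,x,\psi)$ ranging over $U$ and over $\varphi(U)$, respectively, and with arbitrary values of $\nabla\psi$. The triple $((G,F),\varphi,(\tilde G,\tilde F))$ belongs to the equivalence groupoid $\mathcal G^\sim_{\mathscr N}$ if $\varphi$ maps $\mathcal L_{GF}$ to $\mathcal L_{\tilde G\tilde F}$, i.e., if a second-order jet over $U$ at which the prolongation of $\varphi$ is defined satisfies $\mathcal L_{GF}$ if and only if its image under this prolongation satisfies $\mathcal L_{\tilde G\tilde F}$. **Theorem.** The triple $((G,F),\varphi,(\tilde G,\tilde F))$ belongs to $\mathcal G^\sim_{\mathscr N}$ if and only if there is a positive smooth real-valued function $H$ of $(t,x)$ (on the projection of $U$) such that the following holds. 1. On $U$, $$T_\psi=T_{\psi^*}=0,\quad T_a=0,\quad T_t\ne0,\quad X^a_\psi=X^a_{\psi^*}=0,\quad X^b_aX^c_a=H\delta_{bc}.$$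 2. At every point $(t,x,\psi,\nabla\psi)$ over $U$: if $G^*\ne-G$, then $\Psi_\psi\Psi_{\psi^*}=0$. 3. At every point $(t,x,\psi,\nabla\psi)$ over $U$, with $\tilde G$ and $\tilde F$ evaluated at the transformed point $\tilde t=T$, $\tilde x_b=X^b$, $\tilde\psi=\Psi$, $\tilde\psi_{\tilde x_b}=H^{-1}X^b_a\mathrm D_a\Psi$, $$\tilde G=\frac H{T_t}G\ \text{ if }\ \Psi_\psi\ne0,\qquad \tilde G=\frac H{T_t}(-G^*)\ \text{ if }\ \Psi_{\psi^*}\ne0$$ (both equalities hold if both derivatives are nonzero), and $$\tilde F=\frac{\Psi_\psi}{T_t}F-\frac{\Psi_{\psi^*}}{T_t}F^*-\Bigl(\hat\Delta\Psi+\frac{n-2}2\,\frac{H_a}H\,\mathrm D_a\Psi\Bigr)\frac{\tilde G}H-\frac i{T_t}\Bigl(\Psi_t-X^b_t\frac{X^b_a}H\mathrm D_a\Psi\Bigr).$$ Here $\mathrm D_a\Psi=\Psi_a+\psi_a\Psi_\psi+\psi^*_a\Psi_{\psi^*}$ and $\hat\Delta=\partial_{aa}+2\psi_a\partial_{a\psi}+2\psi^*_a\partial_{a\psi^*}+\psi_a\psi_a\partial_{\psi\psi}+2\psi_a\psi^*_a\partial_{\psi\psi^*}+\psi^*_a\psi^*_a\partial_{\psi^*\psi^*}$.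 -/

import Mathlib

open scoped ContDiff ComplexConjugate

noncomputable section

/-- The space of the independent variables `(t, x)`. -/
abbrev Indep (n : ℕ) : Type := ℝ × (Fin n → ℝ)

/-- The space of the variables `(t, x, ψ)`. A function of `(t, x, ψ, ψ*)` is a function on this
space, smoothness is meant over `ℝ`, and derivatives in `ψ`, `ψ*` are Wirtinger derivatives. -/
abbrev Vars (n : ℕ) : Type := ℝ × (Fin n → ℝ) × ℂ

/-- The space of `(t, x, ψ, ∇ψ)`, with `∇ψ` the spatial gradient. -/
abbrev GradVars (n : ℕ) : Type := Vars n × (Fin n → ℂ)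

/-! Partial derivatives of functions of `(t, x)`. -/

section IndepDerivatives

variable {n : ℕ} {E : Type*} [NormedAddCommGroup E] [NormedSpace ℝ E]

/-- `u_t`. -/
def pdT (u : Indep n → E) (q : Indep n) : E := fderiv ℝ u q (1, 0)

/-- `u_a`, the derivative with respect to `x_a`. -/
def pdX (a : Fin n) (u : Indep n → E) (q : Indep n) : E := fderiv ℝ u q (0, Pi.single a 1)

end IndepDerivatives

/-! Partial derivatives of functions of `(t, x, ψ, ψ*)`. -/

section VarsDerivatives

variable {n : ℕ} {E : Type*} [NormedAddCommGroup E] [NormedSpace ℝ E]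

/-- `f_t`. -/
def vdT (f : Vars n → E) (z : Vars n) : E := fderiv ℝ f z (1, 0, 0)

/-- `f_a`, the derivative with respect to `x_a`. -/
def vdX (a : Fin n) (f : Vars n → E) (z : Vars n) : E := fderiv ℝ f z (0, Pi.single a 1, 0)

/-- `f_ψ`. -/
def vdPsi (f : Vars n → ℂ) (z : Vars n) : ℂ :=
  (fderiv ℝ f z (0, 0, 1) - Complex.I * fderiv ℝ f z (0, 0, Complex.I)) / 2

/-- `f_{ψ*}`. -/
def vdPsiBar (f : Vars n → ℂ) (z : Vars n) : ℂ :=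
  (fderiv ℝ f z (0, 0, 1) + Complex.I * fderiv ℝ f z (0, 0, Complex.I)) / 2

/-- The total derivative `D_a f = f_a + ψ_a f_ψ + ψ*_a f_{ψ*}` at `(t, x, ψ, ∇ψ) = (z, p)`. -/
def totalDX (a : Fin n) (f : Vars n → ℂ) (z : Vars n) (p : Fin n → ℂ) : ℂ :=
  vdX a f z + p a * vdPsi f z + conj (p a) * vdPsiBar f z

/-- The operator `∂_aa + 2 ψ_a ∂_{aψ} + 2 ψ*_a ∂_{aψ*} + ψ_a ψ_a ∂_{ψψ} + 2 ψ_a ψ*_a ∂_{ψψ*}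
+ ψ*_a ψ*_a ∂_{ψ*ψ*}` (summation over `a`) at `(t, x, ψ, ∇ψ) = (z, p)`. -/
def hatLaplacian (f : Vars n → ℂ) (z : Vars n) (p : Fin n → ℂ) : ℂ :=
  ∑ a, (vdX a (vdX a f) z
    + 2 * p a * vdX a (vdPsi f) z
    + 2 * conj (p a) * vdX a (vdPsiBar f) z
    + p a * p a * vdPsi (vdPsi f) z
    + 2 * p a * conj (p a) * vdPsi (vdPsiBar f) z
    + conj (p a) * conj (p a) * vdPsiBar (vdPsiBar f) z)

end VarsDerivatives

/-- An equation `i ψ_t + G ψ_aa + F = 0` of the class `𝒩` over a set `V` of values of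
`(t, x, ψ)`: `G` and `F` are smooth functions of `(t, x, ψ, ψ*, ∇ψ, ∇ψ*)` for `(t, x, ψ)` in `V`
and `G` does not vanish. -/
structure ClassN (n : ℕ) (V : Set (Vars n)) where
  G : GradVars n → ℂ
  F : GradVars n → ℂ
  smooth_G : ContDiffOn ℝ ∞ G (V ×ˢ Set.univ)
  smooth_F : ContDiffOn ℝ ∞ F (V ×ˢ Set.univ)
  G_ne_zero : ∀ z ∈ V, ∀ p, G (z, p) ≠ 0

/-- The point `(t, x, ψ, ∇ψ)` given by the function `ψ = u` at `q = (t, x)`. -/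
def gradJet {n : ℕ} (u : Indep n → ℂ) (q : Indep n) : GradVars n :=
  ((q.1, q.2, u q), fun a => pdX a u q)

/-- The second-order jet of `u` at the point `q` lies on the equation. -/
def ClassN.HoldsAt {n : ℕ} {V : Set (Vars n)} (L : ClassN n V) (u : Indep n → ℂ)
    (q : Indep n) : Prop :=
  Complex.I * pdT u q + L.G (gradJet u q) * ∑ a, pdX a (pdX a u) q + L.F (gradJet u q) = 0

/-- A point transformation `t̃ = T`, `x̃_a = X^a`, `ψ̃ = Ψ` of the space of `(t, x, ψ, ψ*)`,
with an open domain of definition and with nonvanishing Jacobian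
(equivalently, `dT ∧ dX^1 ∧ ⋯ ∧ dX^n ∧ dΨ ∧ dΨ* ≠ 0`). -/
structure PointTransformation (n : ℕ) where
  dom : Set (Vars n)
  isOpen_dom : IsOpen dom
  T : Vars n → ℝ
  X : Vars n → Fin n → ℝ
  Ψ : Vars n → ℂ
  smooth_T : ContDiffOn ℝ ∞ T dom
  smooth_X : ContDiffOn ℝ ∞ X dom
  smooth_Ψ : ContDiffOn ℝ ∞ Ψ dom
  nondegenerate : ∀ z ∈ dom, (fderiv ℝ (fun w => (T w, X w, Ψ w) : Vars n → Vars n) z).det ≠ 0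

namespace PointTransformation

variable {n : ℕ} (φ : PointTransformation n)

/-- The transformation as a map. -/
def toMap (z : Vars n) : Vars n := (φ.T z, φ.X z, φ.Ψ z)

/-- The image of the transformation. -/
def image : Set (Vars n) := φ.toMap '' φ.dom

/-- The new independent variables along the graph of `u`, as functions of the old ones. -/
def newIndep (u : Indep n → ℂ) (q : Indep n) : Indep n :=
  (φ.T (q.1, q.2, u q), φ.X (q.1, q.2, u q))

/-- The prolongation of `φ` to jets: near the point `q`, the transformation `φ` maps the graph
of `u` to the graph of the function `v` (near the image point), where the total Jacobian
`det (D_μ X^ν)`, `X^0 = T`, does not vanish at `q`. So the jets of `v` at `φ.newIndep u q` are the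
images of the jets of `u` at `q` under the standard prolongations of `φ`. -/
structure CarriesAt (u : Indep n → ℂ) (q : Indep n) (v : Indep n → ℂ) : Prop where
  mem_dom : (q.1, q.2, u q) ∈ φ.dom
  smooth_source : ContDiffAt ℝ ∞ u q
  smooth_target : ContDiffAt ℝ ∞ v (φ.newIndep u q)
  total_jacobian : (fderiv ℝ (φ.newIndep u) q).det ≠ 0
  eq_near : ∀ᶠ r in nhds q, v (φ.newIndep u r) = φ.Ψ (r.1, r.2, u r)

/-- `φ` maps the equation `L` to the equation `L'`, i.e. `(L, φ, L')` is an admissible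
transformation, an element of the equivalence groupoid of the class `𝒩`: the second-order
prolongation of `φ` maps the subset of the jet space defined by `L` (together with the
conjugate equation) to the one defined by `L'`, and so does its inverse in the opposite
direction. -/
def IsAdmissible (L : ClassN n φ.dom) (L' : ClassN n φ.image) : Prop :=
  ∀ (u : Indep n → ℂ) (q : Indep n) (v : Indep n → ℂ), φ.CarriesAt u q v →
    (L.HoldsAt u q ↔ L'.HoldsAt v (φ.newIndep u q))

/-- The projection of the domain to the space of `(t, x)`. -/
def indepDom : Set (Indep n) := (fun z : Vars n => (z.1, z.2.1)) '' φ.dom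

/-- The system `T_ψ = T_{ψ*} = 0`, `T_a = 0`, `T_t ≠ 0`, `X^a_ψ = X^a_{ψ*} = 0`,
`X^b_a X^c_a = H δ_bc` on the domain, with a positive smooth function `H` of `(t, x)`. -/
structure IsConformalWith (H : Indep n → ℝ) : Prop where
  smooth_H : ContDiffOn ℝ ∞ H φ.indepDom
  H_pos : ∀ q ∈ φ.indepDom, 0 < H q
  T_psi : ∀ z ∈ φ.dom, vdPsi (fun w => (φ.T w : ℂ)) z = 0
  T_psiBar : ∀ z ∈ φ.dom, vdPsiBar (fun w => (φ.T w : ℂ)) z = 0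
  T_x : ∀ z ∈ φ.dom, ∀ a, vdX a φ.T z = 0
  T_t : ∀ z ∈ φ.dom, vdT φ.T z ≠ 0
  X_psi : ∀ z ∈ φ.dom, ∀ a, vdPsi (fun w => (φ.X w a : ℂ)) z = 0
  X_psiBar : ∀ z ∈ φ.dom, ∀ a, vdPsiBar (fun w => (φ.X w a : ℂ)) z = 0
  conformal : ∀ z ∈ φ.dom, ∀ b c,
    ∑ a, vdX a (fun w => φ.X w b) z * vdX a (fun w => φ.X w c) z
      = if b = c then H (z.1, z.2.1) else 0

/-- For transformations with `T = T(t)`, `X = X(t, x)`, `X^b_a X^c_a = H δ_bc`, the transformed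
values of `(t, x, ψ, ∇ψ)`; the chain rule `D_a Ψ = ψ̃_b X^b_a` gives
`ψ̃_b = H⁻¹ X^b_a D_a Ψ`. -/
def newGradVars (H : Indep n → ℝ) (z : Vars n) (p : Fin n → ℂ) : GradVars n :=
  (φ.toMap z, fun b =>
    ∑ a, ((vdX a (fun w => φ.X w b) z / H (z.1, z.2.1) : ℝ) : ℂ) * totalDX a φ.Ψ z p)

/-- The expression of the transformed arbitrary element `F̃`, where `g` is the value of `G̃`. -/
def newF (H : Indep n → ℝ) (F : GradVars n → ℂ) (g : ℂ) (z : Vars n) (p : Fin n → ℂ) : ℂ :=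
  vdPsi φ.Ψ z / ((vdT φ.T z : ℝ) : ℂ) * F (z, p)
    - vdPsiBar φ.Ψ z / ((vdT φ.T z : ℝ) : ℂ) * conj (F (z, p))
    - (hatLaplacian φ.Ψ z p
        + ((n : ℂ) - 2) / 2 *
          ∑ a, ((pdX a H (z.1, z.2.1) / H (z.1, z.2.1) : ℝ) : ℂ) * totalDX a φ.Ψ z p)
      * (g / (H (z.1, z.2.1) : ℂ))
    - Complex.I / ((vdT φ.T z : ℝ) : ℂ) *
      (vdT φ.Ψ z - ∑ b, ∑ a, ((vdT (fun w => φ.X w b) z * vdX a (fun w => φ.X w b) z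
          / H (z.1, z.2.1) : ℝ) : ℂ) * totalDX a φ.Ψ z p)

end PointTransformation

end

/-! ### Second derivatives -/

section SecondDerivatives

variable {E F K : Type*} [NormedAddCommGroup E] [NormedSpace ℝ E] [NormedAddCommGroup F]
  [NormedSpace ℝ F] [NormedAddCommGroup K] [NormedSpace ℝ K]

/-! Jets are realised by functions: near a point, `φ` carries the graph of `u` to that of `v` when
`v ∘ (T, X)` and `Ψ` agree along the graph of `u`. Differentiating this identity once and twice
gives the prolongation (`fderiv_target`, `fderiv_fderiv_target`). Quadratic polynomials realise
every 2-jet that is needed.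

Necessity. Fix a first-order jet with invertible total Jacobian `J`. Both equations are then affine
in the Hessian `B` of `ψ`: the old one sees only the spatial trace of `B`, the new one only an
injective real-linear image of the spatial trace of the pullback of `B` along `J⁻¹`
(`exists_affine_condition`). As the equations are equivalent, the second trace vanishes whenever the
first does. Testing this on elementary symmetric forms shows that `J` maps spatial vectors to
spatial vectors, conformally (`conformal_of_trace_vanishing`, `totalJacobian_conformal`).

This holds for all nearby gradients, and changing one component of the gradient changes one column
of `J` by a multiple of a fibre derivative `ξ` of `(T, X)`. The second difference of `J Jᵀ` makes
the spatial part of `ξ ξᵀ` a scalar matrix. It has rank at most one, so it vanishes for `n ≥ 2`.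
Hence `T` and `X` do not depend on `ψ`, and the conformal system follows. Connected fibres make the
factor `H` a function of `(t, x)` alone.

Under the conformal system the new left-hand side is computed explicitly (`transformed_equation`).
The Laplacian of `X` enters only through `H`, which is the source of the coefficient `(n - 2) / 2`
(`sum_laplacian_X_mul`). On solutions of the old equation, admissibility becomes a real-affine
identity in the free value `ψ_aa`, whose coefficients give the formulas for `G̃` and `F̃`
(`arbitrary_elements`).

Sufficiency. With these formulas, `T_t` times the new left-hand side equals `Ψ_ψ E - Ψ_{ψ*} E*`,
where `E` is the old left-hand side. Nondegeneracy of `φ` in the `ψ`-direction makes this vanish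
exactly when `E` does. -/

theorem ContDiffAt.differentiableAt_of_smooth {f : E → F} {x : E} (hf : ContDiffAt ℝ ∞ f x) :
    DifferentiableAt ℝ f x :=
  hf.differentiableAt (by simp)

theorem ContDiffAt.eventually_of_smooth {f : E → F} {x : E} (hf : ContDiffAt ℝ ∞ f x) :
    ∀ᶠ y in nhds x, DifferentiableAt ℝ f y := by
  have h1 : ContDiffAt ℝ 1 f x := hf.of_le (by exact_mod_cast le_top)
  filter_upwards [h1.eventually (by simp)] with y hy
  exact hy.differentiableAt (by simp)

theorem ContDiffAt.fderiv_of_smooth {f : E → F} {x : E} (hf : ContDiffAt ℝ ∞ f x) :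
    ContDiffAt ℝ ∞ (fderiv ℝ f) x :=
  hf.fderiv_right (by simp)

theorem ContDiffAt.fderiv_fderiv_comm {f : E → F} {x : E} (hf : ContDiffAt ℝ ∞ f x) (a b : E) :
    fderiv ℝ (fderiv ℝ f) x a b = fderiv ℝ (fderiv ℝ f) x b a :=
  (hf.isSymmSndFDerivAt (by simpa using (mod_cast le_top : ((2 : ℕ∞) : WithTop ℕ∞) ≤ ∞))) a b

theorem ContDiffAt.fderiv_fderiv_apply {f : E → F} {x : E} (hf : ContDiffAt ℝ ∞ f x) (a b : E) :
    fderiv ℝ (fun y => fderiv ℝ f y a) x b = fderiv ℝ (fderiv ℝ f) x b a := by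
  rw [fderiv_clm_apply hf.fderiv_of_smooth.differentiableAt_of_smooth
    (differentiableAt_const a)]
  simp

/-- The chain rule of second order. -/
theorem fderiv_fderiv_comp {g : F → K} {f : E → F} {x : E} (hg : ContDiffAt ℝ ∞ g (f x))
    (hf : ContDiffAt ℝ ∞ f x) (a b : E) :
    fderiv ℝ (fderiv ℝ (fun y => g (f y))) x a b
      = fderiv ℝ (fderiv ℝ g) (f x) (fderiv ℝ f x a) (fderiv ℝ f x b)
        + fderiv ℝ g (f x) (fderiv ℝ (fderiv ℝ f) x a b) := by
  have hev : fderiv ℝ (fun y => g (f y)) =ᶠ[nhds x]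
      fun y => (fderiv ℝ g (f y)).comp (fderiv ℝ f y) := by
    filter_upwards [hf.continuousAt.eventually hg.eventually_of_smooth,
      hf.eventually_of_smooth] with y h1 h2
    exact fderiv_comp y h1 h2
  have hd : DifferentiableAt ℝ (fderiv ℝ g) (f x) :=
    hg.fderiv_of_smooth.differentiableAt_of_smooth
  have h1 : HasFDerivAt (fun y => fderiv ℝ g (f y))
      ((fderiv ℝ (fderiv ℝ g) (f x)).comp (fderiv ℝ f x)) x :=
    hd.hasFDerivAt.comp x hf.differentiableAt_of_smooth.hasFDerivAt
  have h2 := hf.fderiv_of_smooth.differentiableAt_of_smooth.hasFDerivAt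
  rw [hev.fderiv_eq, (h1.clm_comp h2).fderiv]
  simp [add_comm]

/-- The quadratic function with prescribed value, first and second derivative at `q`. -/
noncomputable def quadraticAt (q : E) (w : F) (p : E →L[ℝ] F) (B : E →L[ℝ] E →L[ℝ] F) (r : E) : F :=
  w + p (r - q) + (1 / 2 : ℝ) • B (r - q) (r - q)

variable (q : E) (w : F) (p : E →L[ℝ] F) (B : E →L[ℝ] E →L[ℝ] F)

@[simp] theorem quadraticAt_self : quadraticAt q w p B q = w := by simp [quadraticAt]

theorem contDiff_quadraticAt : ContDiff ℝ ∞ (quadraticAt q w p B) := by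
  unfold quadraticAt
  fun_prop

variable {B}

/-- Symmetry merges the two product-rule terms, and the factor `1 / 2` cancels the resulting 2. -/
theorem fderiv_quadraticAt (hB : ∀ a b, B a b = B b a) (r : E) :
    fderiv ℝ (quadraticAt q w p B) r = p + B (r - q) := by
  have h0 : HasFDerivAt (fun r : E => r - q) (ContinuousLinearMap.id ℝ E) r :=
    (hasFDerivAt_id r).sub_const q
  have h1 : HasFDerivAt (fun r => p (r - q)) (p.comp (ContinuousLinearMap.id ℝ E)) r :=
    p.hasFDerivAt.comp r h0
  have h2 : HasFDerivAt (fun r => B (r - q)) (B.comp (ContinuousLinearMap.id ℝ E)) r :=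
    B.hasFDerivAt.comp r h0
  have h3 := ((h1.const_add w).add ((h2.clm_apply h0).const_smul (1 / 2 : ℝ)))
  have h4 : fderiv ℝ (quadraticAt q w p B) r = _ := h3.fderiv
  rw [h4]
  ext a
  simp only [ContinuousLinearMap.comp_id, add_apply,
    smul_apply, ContinuousLinearMap.flip_apply]
  rw [hB a, ← two_smul ℝ, smul_smul]
  norm_num

theorem fderiv_quadraticAt_self (hB : ∀ a b, B a b = B b a) :
    fderiv ℝ (quadraticAt q w p B) q = p := by
  simp [fderiv_quadraticAt q w p hB]

theorem fderiv_fderiv_quadraticAt (hB : ∀ a b, B a b = B b a) :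
    fderiv ℝ (fderiv ℝ (quadraticAt q w p B)) q = B := by
  have h : fderiv ℝ (quadraticAt q w p B) = fun r => p + B (r - q) :=
    funext (fderiv_quadraticAt q w p hB)
  have h0 : HasFDerivAt (fun r : E => r - q) (ContinuousLinearMap.id ℝ E) q :=
    (hasFDerivAt_id q).sub_const q
  have h2 : HasFDerivAt (fun r => p + B (r - q)) (B.comp (ContinuousLinearMap.id ℝ E)) q :=
    (B.hasFDerivAt.comp q h0).const_add p
  rw [h, h2.fderiv]
  simp

end SecondDerivatives

/-! ### Linear algebra -/

/-- If `A` and `B` together span the target, `A` can be corrected to an injective map by means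
of `B`. -/
theorem LinearMap.exists_injective_add_comp {V W : Type*} [AddCommGroup V] [Module ℝ V]
    [FiniteDimensional ℝ V] [AddCommGroup W] [Module ℝ W] (A : V →ₗ[ℝ] V) (B : W →ₗ[ℝ] V)
    (hAB : LinearMap.range A ⊔ LinearMap.range B = ⊤) :
    ∃ p : V →ₗ[ℝ] W, Function.Injective (A + B ∘ₗ p) := by
  let π := (LinearMap.range A).mkQ
  have hs : Function.Surjective (π ∘ₗ B) := by
    intro y
    obtain ⟨v, rfl⟩ := (LinearMap.range A).mkQ_surjective y
    have hv : v ∈ LinearMap.range A ⊔ LinearMap.range B := hAB ▸ Submodule.mem_top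
    obtain ⟨_, ⟨a, rfl⟩, _, ⟨b, rfl⟩, rfl⟩ := Submodule.mem_sup.1 hv
    exact ⟨b, by simp [π]⟩
  obtain ⟨s, hsec⟩ := (π ∘ₗ B).exists_rightInverse_of_surjective (LinearMap.range_eq_top.2 hs)
  -- For an endomorphism, kernel and cokernel have the same dimension, so the correction can match
  -- them isomorphically.
  have hdim : Module.finrank ℝ (LinearMap.ker A)
      = Module.finrank ℝ (V ⧸ LinearMap.range A) := by
    have h1 := A.finrank_range_add_finrank_ker
    have h2 := (LinearMap.range A).finrank_quotient_add_finrank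
    omega
  let e : LinearMap.ker A ≃ₗ[ℝ] (V ⧸ LinearMap.range A) := LinearEquiv.ofFinrankEq _ _ hdim
  obtain ⟨r, hr⟩ := (LinearMap.ker A).subtype.exists_leftInverse_of_injective (by simp)
  have hr' : ∀ k : LinearMap.ker A, r k = k := fun k => LinearMap.congr_fun hr k
  -- Project to `ker A`, identify it with the cokernel, and lift through `B`. Modulo `range A` only
  -- the correction survives, so a vector killed by the sum has zero projection to `ker A`; it then
  -- lies in `ker A` and is zero.
  refine ⟨s ∘ₗ e.toLinearMap ∘ₗ r, ?_⟩
  rw [← LinearMap.ker_eq_bot, LinearMap.ker_eq_bot']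
  intro v hv
  have hv1 : A v + B (s (e (r v))) = 0 := hv
  have h1 : π (B (s (e (r v)))) = e (r v) := LinearMap.congr_fun hsec _
  have h2 : π (A v) = 0 := by simp [π]
  have h3 : e (r v) = 0 := by
    have h := congrArg π hv1
    rwa [map_add, h2, h1, zero_add, map_zero] at h
  have h4 : r v = 0 := by simpa using h3
  have h5 : A v = 0 := by simpa [h4] using hv1
  have h6 := hr' ⟨v, h5⟩
  rw [h4] at h6
  simpa using congrArg Subtype.val h6.symm

theorem ContinuousLinearMap.det_ne_zero_of_injective {V : Type*} [NormedAddCommGroup V]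
    [NormedSpace ℝ V] [FiniteDimensional ℝ V] {A : V →L[ℝ] V} (hA : Function.Injective A) :
    A.det ≠ 0 := by
  intro h
  have := LinearMap.bot_lt_ker_of_det_eq_zero (f := (A : V →ₗ[ℝ] V)) h
  rw [LinearMap.ker_eq_bot.2 (show Function.Injective (A : V →ₗ[ℝ] V) from hA)] at this
  exact lt_irrefl _ this

theorem ContinuousLinearMap.injective_of_det_ne_zero {V : Type*} [NormedAddCommGroup V]
    [NormedSpace ℝ V] [FiniteDimensional ℝ V] {A : V →L[ℝ] V} (hA : A.det ≠ 0) :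
    Function.Injective A := by
  intro x y hxy
  rw [← A.toContinuousLinearEquivOfDetNeZero_apply hA,
    ← A.toContinuousLinearEquivOfDetNeZero_apply hA] at hxy
  exact (A.toContinuousLinearEquivOfDetNeZero hA).injective hxy

/-- The vector of the `x_a`-axis in the space of `(t, x)`. -/
def axisX {n : ℕ} (a : Fin n) : Indep n := (0, Pi.single a 1)

theorem spatial_eq_sum_axisX {n : ℕ} (y : Fin n → ℝ) :
    ((0, y) : Indep n) = ∑ a, y a • axisX a := by
  ext i
  · simp [axisX, Prod.fst_sum]
  · simp [axisX, Prod.snd_sum, Finset.sum_apply, Pi.single_apply]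

/-- The product `f ⊗ g` of linear forms, with values in `ℂ`. -/
noncomputable def formProd {E : Type*} [NormedAddCommGroup E] [NormedSpace ℝ E]
    (f g : E →L[ℝ] ℝ) (c : ℂ) : E →L[ℝ] E →L[ℝ] ℂ :=
  f.smulRight (g.smulRight c)

@[simp] theorem formProd_apply {E : Type*} [NormedAddCommGroup E] [NormedSpace ℝ E]
    (f g : E →L[ℝ] ℝ) (c : ℂ) (a b : E) :
    formProd f g c a b = ((f a * g b : ℝ) : ℂ) * c := by
  simp [formProd, mul_assoc]

/-- The coordinate `t` as a linear form. -/
noncomputable def formT (n : ℕ) : Indep n →L[ℝ] ℝ := ContinuousLinearMap.fst ℝ ℝ (Fin n → ℝ)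

/-- The coordinate `x_a` as a linear form. -/
noncomputable def formX {n : ℕ} (a : Fin n) : Indep n →L[ℝ] ℝ :=
  (ContinuousLinearMap.proj a).comp (ContinuousLinearMap.snd ℝ ℝ (Fin n → ℝ))

@[simp] theorem formT_apply {n : ℕ} (q : Indep n) : formT n q = q.1 := rfl

@[simp] theorem formX_apply {n : ℕ} (a : Fin n) (q : Indep n) : formX a q = q.2 a := rfl

/-- A linear automorphism `N` of the space of `(t, x)` such that the spatial trace and the trace
of the pullback along `N⁻¹` vanish on the same symmetric forms maps spatial vectors to spatial
vectors, conformally. -/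
theorem conformal_of_trace_vanishing {n : ℕ} (hn : 0 < n) (N : Indep n ≃L[ℝ] Indep n)
    (h : ∀ B : Indep n →L[ℝ] Indep n →L[ℝ] ℂ, (∀ a b, B a b = B b a) →
      ∑ a, B (axisX a) (axisX a) = 0 → ∑ b, B (N.symm (axisX b)) (N.symm (axisX b)) = 0) :
    (∀ a, (N (axisX a)).1 = 0) ∧ ∃ c : ℝ, 0 < c ∧ ∀ i j,
      ∑ a, (N (axisX a)).2 i * (N (axisX a)).2 j = if i = j then c else 0 := by
  -- The test form `dt ⊗ dt` has no spatial trace; its pullback has as trace a sum of real squares.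
  have hT : ∀ b, (N.symm (axisX b)).1 = 0 := by
    have h1 := h (formProd (formT n) (formT n) 1) (by intro a b; simp [mul_comm]) (by simp [axisX])
    simp only [formProd_apply, formT_apply, mul_one] at h1
    have h2 : ∑ b, (N.symm (axisX b)).1 * (N.symm (axisX b)).1 = 0 := by exact_mod_cast h1
    intro b
    have h3 := (Finset.sum_eq_zero_iff_of_nonneg (fun b _ => mul_self_nonneg _)).1 h2 b
      (Finset.mem_univ b)
    exact mul_self_eq_zero.1 h3
  let k : Matrix (Fin n) (Fin n) ℝ := fun i b => (N.symm (axisX b)).2 i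
  let M : Matrix (Fin n) (Fin n) ℝ := fun b i => (N (axisX i)).2 b
  -- The symmetrised `dx_i ⊗ dx_j` gives orthogonality of distinct rows of `k`. Below, `dx_i ⊗ dx_i
  -- - dx_j ⊗ dx_j` gives equal norms.
  have hoff : ∀ i j, i ≠ j → ∑ b, k i b * k j b = 0 := by
    intro i j hij
    have h1 := h (formProd (formX i) (formX j) 1 + formProd (formX j) (formX i) 1)
      (by intro a b; simp; ring)
      (by
        simp only [add_apply, formProd_apply, formX_apply, axisX]
        apply Finset.sum_eq_zero
        intro a _
        by_cases hia : a = i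
        · subst hia; simp [hij.symm]
        · simp [Pi.single_apply, Ne.symm hia])
    simp only [add_apply, formProd_apply, formX_apply, mul_one] at h1
    have h2 : ∑ b, (k i b * k j b + k j b * k i b) = 0 := by exact_mod_cast h1
    simp only [mul_comm (k j _), ← two_mul, ← Finset.mul_sum] at h2
    linarith
  have hdiag : ∀ i j, ∑ b, k i b * k i b = ∑ b, k j b * k j b := by
    intro i j
    have h1 := h (formProd (formX i) (formX i) 1 - formProd (formX j) (formX j) 1)
      (by intro a b; simp; ring)
      (by
        have hs : ∀ i : Fin n, ∑ a, (Pi.single a (1 : ℝ) : Fin n → ℝ) i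
            * (Pi.single a (1 : ℝ) : Fin n → ℝ) i = 1 := by
          intro i
          rw [Finset.sum_eq_single i (fun b _ hb => by simp [hb.symm]) (by simp)]
          simp
        simp only [sub_apply, formProd_apply, formX_apply, axisX, mul_one,
          Finset.sum_sub_distrib, ← Complex.ofReal_sum, hs, sub_self])
    simp only [sub_apply, formProd_apply, formX_apply, mul_one] at h1
    have h2 : ∑ b, (k i b * k i b - k j b * k j b) = 0 := by exact_mod_cast h1
    rw [Finset.sum_sub_distrib] at h2
    linarith
  let i0 : Fin n := ⟨0, hn⟩
  let c : ℝ := ∑ b, k i0 b * k i0 b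
  have hkk : k * k.transpose = c • (1 : Matrix (Fin n) (Fin n) ℝ) := by
    ext i j
    by_cases hij : i = j
    · subst hij
      simpa [Matrix.mul_apply, c] using hdiag i i0
    · simpa [Matrix.mul_apply, hij] using hoff i j hij
  -- Since `N⁻¹` maps spatial vectors to spatial vectors, the time column of `N` does not enter and
  -- the spatial blocks are mutually inverse.
  have hMk : M * k = 1 := by
    ext b i
    have h1 : N.symm (axisX i) = ∑ a, k a i • axisX a := by
      rw [← spatial_eq_sum_axisX]
      exact Prod.ext (hT i) rfl
    have h2 : axisX i = ∑ a, k a i • N (axisX a) := by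
      rw [← N.apply_symm_apply (axisX i), h1]
      simp
    have h3 := congrFun (congrArg Prod.snd h2) b
    simp only [Prod.snd_sum, Finset.sum_apply, Prod.smul_snd, Pi.smul_apply, smul_eq_mul] at h3
    rw [Matrix.mul_apply, Matrix.one_apply]
    simp only [axisX, Pi.single_apply] at h3
    rw [h3]
    exact Finset.sum_congr rfl fun a _ => mul_comm _ _
  have hkM : k * M = 1 := mul_eq_one_comm.1 hMk
  have hkt : k.transpose = c • M := by
    calc k.transpose = M * k * k.transpose := by rw [hMk, one_mul]
      _ = c • M := by rw [mul_assoc, hkk]; simp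
  have hMM : c • (M * M.transpose) = 1 := by
    have h1 : (M * k).transpose = 1 := by rw [hMk, Matrix.transpose_one]
    rw [Matrix.transpose_mul, hkt] at h1
    simpa using h1
  have hc : 0 < c := by
    have h0 : 0 ≤ c := Finset.sum_nonneg fun b _ => mul_self_nonneg _
    refine lt_of_le_of_ne h0 fun h1 => ?_
    have h2 := congrFun (congrFun hMM i0) i0
    rw [← h1] at h2
    simp at h2
  refine ⟨fun a => ?_, c⁻¹, inv_pos.2 hc, fun i j => ?_⟩
  · have h1 : axisX a = ∑ b, M b a • N.symm (axisX b) := by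
      ext i
      · simp only [Prod.fst_sum, Prod.smul_fst, hT]
        simp [axisX]
      · have h2 := congrFun (congrFun hkM i) a
        rw [Matrix.mul_apply, Matrix.one_apply] at h2
        simp only [axisX, Prod.snd_sum, Finset.sum_apply, Prod.smul_snd, Pi.smul_apply,
          smul_eq_mul, Pi.single_apply]
        rw [← h2]
        exact Finset.sum_congr rfl fun b _ => mul_comm _ _
    rw [h1]
    simp [Prod.fst_sum, axisX]
  · have h1 := congrFun (congrFun hMM i) j
    simp only [Matrix.smul_apply, Matrix.mul_apply, Matrix.transpose_apply, smul_eq_mul,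
      Matrix.one_apply] at h1
    change ∑ a, M i a * M j a = _
    rw [← mul_right_inj' hc.ne', h1]
    split_ifs <;> simp [hc.ne']

/-! ### Prolongation of point transformations -/

section Graphs

variable {n : ℕ}

/-- The inclusion of the space of `(t, x)` into the space of `(t, x, ψ)` along the graph of a
linear map. -/
noncomputable def graphCLM (p : Indep n →L[ℝ] ℂ) : Indep n →L[ℝ] Vars n :=
  (ContinuousLinearMap.fst ℝ ℝ (Fin n → ℝ)).prod
    ((ContinuousLinearMap.snd ℝ ℝ (Fin n → ℝ)).prod p)

/-- The inclusion of the `ψ`-axis. -/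
noncomputable def fibreCLM (n : ℕ) : ℂ →L[ℝ] Vars n :=
  (ContinuousLinearMap.inr ℝ ℝ ((Fin n → ℝ) × ℂ)).comp (ContinuousLinearMap.inr ℝ (Fin n → ℝ) ℂ)

@[simp] theorem graphCLM_apply (p : Indep n →L[ℝ] ℂ) (a : Indep n) :
    graphCLM p a = (a.1, a.2, p a) := rfl

@[simp] theorem fibreCLM_apply (w : ℂ) : fibreCLM n w = (0, 0, w) := rfl

theorem graphCLM_eq (p : Indep n →L[ℝ] ℂ) :
    graphCLM p = graphCLM 0 + (fibreCLM n).comp p := by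
  ext <;> simp

/-- The point `(t, x, u(t, x))` of the graph of `u`. -/
def graphMap (u : Indep n → ℂ) (r : Indep n) : Vars n := (r.1, r.2, u r)

variable {u : Indep n → ℂ} {q : Indep n}

theorem graphMap_eq (u : Indep n → ℂ) :
    graphMap u = fun r => graphCLM 0 r + fibreCLM n (u r) := by
  ext r <;> simp [graphMap]

theorem contDiffAt_graphMap (hu : ContDiffAt ℝ ∞ u q) : ContDiffAt ℝ ∞ (graphMap u) q := by
  rw [graphMap_eq]
  fun_prop

theorem fderiv_graphMap (hu : DifferentiableAt ℝ u q) :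
    fderiv ℝ (graphMap u) q = graphCLM (fderiv ℝ u q) := by
  have h := (graphCLM (0 : Indep n →L[ℝ] ℂ)).hasFDerivAt (x := q) |>.add
    ((fibreCLM n).hasFDerivAt.comp q hu.hasFDerivAt)
  rw [graphMap_eq, graphCLM_eq (fderiv ℝ u q)]
  exact h.fderiv

theorem fderiv_fderiv_graphMap (hu : ContDiffAt ℝ ∞ u q) (a b : Indep n) :
    fderiv ℝ (fderiv ℝ (graphMap u)) q a b = (0, 0, fderiv ℝ (fderiv ℝ u) q a b) := by
  have hev : fderiv ℝ (graphMap u) =ᶠ[nhds q]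
      fun r => graphCLM 0 + (fibreCLM n).comp (fderiv ℝ u r) := by
    filter_upwards [hu.eventually_of_smooth] with r hr
    rw [fderiv_graphMap hr, graphCLM_eq]
  have h1 := hu.fderiv_of_smooth.differentiableAt_of_smooth.hasFDerivAt
  have h2 := (((hasFDerivAt_const (fibreCLM n) q).clm_comp h1).const_add (graphCLM 0))
  rw [hev.fderiv_eq, h2.fderiv]
  simp

end Graphs

namespace PointTransformation

variable {n : ℕ} (φ : PointTransformation n)

/-- The part `(T, X)` of the transformation. -/
def base (z : Vars n) : Indep n := (φ.T z, φ.X z)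

variable {φ} {z : Vars n}

theorem contDiffAt_T (hz : z ∈ φ.dom) : ContDiffAt ℝ ∞ φ.T z :=
  φ.smooth_T.contDiffAt (φ.isOpen_dom.mem_nhds hz)

theorem contDiffAt_X (hz : z ∈ φ.dom) : ContDiffAt ℝ ∞ φ.X z :=
  φ.smooth_X.contDiffAt (φ.isOpen_dom.mem_nhds hz)

theorem contDiffAt_X_apply (hz : z ∈ φ.dom) (b : Fin n) :
    ContDiffAt ℝ ∞ (fun w => φ.X w b) z :=
  contDiffAt_pi.1 (contDiffAt_X hz) b

theorem contDiffAt_Ψ (hz : z ∈ φ.dom) : ContDiffAt ℝ ∞ φ.Ψ z :=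
  φ.smooth_Ψ.contDiffAt (φ.isOpen_dom.mem_nhds hz)

theorem contDiffAt_base (hz : z ∈ φ.dom) : ContDiffAt ℝ ∞ φ.base z :=
  (contDiffAt_T hz).prodMk (contDiffAt_X hz)

theorem fderiv_X_apply (hz : z ∈ φ.dom) (b : Fin n) (a : Vars n) :
    fderiv ℝ (fun w => φ.X w b) z a = fderiv ℝ φ.X z a b := by
  rw [fderiv_apply (contDiffAt_X hz).differentiableAt_of_smooth]
  rfl

theorem fderiv_base (hz : z ∈ φ.dom) (a : Vars n) :
    fderiv ℝ φ.base z a = (fderiv ℝ φ.T z a, fderiv ℝ φ.X z a) := by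
  have h := (contDiffAt_T hz).differentiableAt_of_smooth.fderiv_prodMk
    (contDiffAt_X hz).differentiableAt_of_smooth
  change fderiv ℝ (fun w => (φ.T w, φ.X w)) z a = _
  rw [h]
  rfl

/-- The Jacobian condition in the form used below: no nonzero tangent vector is annihilated by both
the base part and `Ψ`. -/
theorem eq_zero_of_fderiv_eq_zero (hz : z ∈ φ.dom) {a : Vars n}
    (h1 : fderiv ℝ φ.base z a = 0) (h2 : fderiv ℝ φ.Ψ z a = 0) : a = 0 := by
  have hinj := ContinuousLinearMap.injective_of_det_ne_zero (φ.nondegenerate z hz)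
  apply hinj
  have hX : DifferentiableAt ℝ (fun w => (φ.X w, φ.Ψ w)) z :=
    (contDiffAt_X hz).differentiableAt_of_smooth.prodMk
      (contDiffAt_Ψ hz).differentiableAt_of_smooth
  rw [(contDiffAt_T hz).differentiableAt_of_smooth.fderiv_prodMk hX,
    (contDiffAt_X hz).differentiableAt_of_smooth.fderiv_prodMk
      (contDiffAt_Ψ hz).differentiableAt_of_smooth]
  rw [fderiv_base hz] at h1
  simp only [Prod.mk_eq_zero] at h1
  simp [h1.1, h1.2, h2]

/-- The derivative of `(T, X)` is surjective. -/
theorem exists_fderiv_eq (hz : z ∈ φ.dom) (y : Indep n) : ∃ a, fderiv ℝ φ.base z a = y := by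
  let A : Vars n →ₗ[ℝ] Vars n := (fderiv ℝ φ.T z : Vars n →ₗ[ℝ] ℝ).prod
    ((fderiv ℝ φ.X z : Vars n →ₗ[ℝ] (Fin n → ℝ)).prod (fderiv ℝ φ.Ψ z : Vars n →ₗ[ℝ] ℂ))
  have hA : Function.Injective A := by
    rw [← LinearMap.ker_eq_bot, LinearMap.ker_eq_bot']
    intro a ha
    have h1 : fderiv ℝ φ.T z a = 0 := congrArg Prod.fst ha
    have h2 : fderiv ℝ φ.X z a = 0 := congrArg (fun v : Vars n => v.2.1) ha
    have h3 : fderiv ℝ φ.Ψ z a = 0 := congrArg (fun v : Vars n => v.2.2) ha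
    exact eq_zero_of_fderiv_eq_zero hz (by rw [fderiv_base hz, h1, h2]; rfl) h3
  obtain ⟨a, ha⟩ := (LinearMap.injective_iff_surjective.1 hA) (y.1, y.2, 0)
  refine ⟨a, ?_⟩
  rw [fderiv_base hz]
  exact Prod.ext (congrArg (fun v : Vars n => v.1) ha) (congrArg (fun v : Vars n => v.2.1) ha)

variable (φ) in
/-- The total Jacobian matrix `D_μ X^ν`, `X^0 = T`, at a first-order jet. -/
noncomputable def totalJacobian (z : Vars n) (p : Indep n →L[ℝ] ℂ) : Indep n →L[ℝ] Indep n :=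
  (fderiv ℝ φ.base z).comp (graphCLM p)

theorem totalJacobian_apply (p : Indep n →L[ℝ] ℂ) (a : Indep n) :
    φ.totalJacobian z p a = fderiv ℝ φ.base z (a.1, a.2, p a) := rfl

/-- At every point there is a first-order jet at which the prolongation of `φ` is defined. -/
theorem exists_totalJacobian_det_ne_zero (hz : z ∈ φ.dom) :
    ∃ p, (φ.totalJacobian z p).det ≠ 0 := by
  -- The total Jacobian at `p` is `A + B ∘ p`, with `B` the fibre derivative of `(T, X)`, and
  -- surjectivity of the full derivative of `(T, X)` says that the two ranges span.
  let A : Indep n →ₗ[ℝ] Indep n := (φ.totalJacobian z 0 : Indep n →ₗ[ℝ] Indep n)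
  let B : ℂ →ₗ[ℝ] Indep n := ((fderiv ℝ φ.base z).comp (fibreCLM n) : ℂ →ₗ[ℝ] Indep n)
  have hAB : LinearMap.range A ⊔ LinearMap.range B = ⊤ := by
    rw [eq_top_iff]
    rintro y -
    obtain ⟨a, rfl⟩ := exists_fderiv_eq hz y
    refine Submodule.mem_sup.2 ⟨A (a.1, a.2.1), ⟨_, rfl⟩, B a.2.2, ⟨_, rfl⟩, ?_⟩
    change fderiv ℝ φ.base z (a.1, a.2.1, 0) + fderiv ℝ φ.base z (0, 0, a.2.2) = _
    rw [← map_add]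
    simp
  obtain ⟨p, hp⟩ := A.exists_injective_add_comp B hAB
  refine ⟨LinearMap.toContinuousLinearMap p, ContinuousLinearMap.det_ne_zero_of_injective ?_⟩
  convert hp using 1
  ext1 a
  change fderiv ℝ φ.base z (a.1, a.2, p a)
    = fderiv ℝ φ.base z (a.1, a.2, 0) + fderiv ℝ φ.base z (0, 0, p a)
  rw [← map_add]
  simp

variable {u v : Indep n → ℂ} {q : Indep n}

theorem newIndep_eq (u : Indep n → ℂ) : φ.newIndep u = fun r => φ.base (graphMap u r) := rfl

theorem contDiffAt_newIndep (hz : graphMap u q ∈ φ.dom) (hu : ContDiffAt ℝ ∞ u q) :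
    ContDiffAt ℝ ∞ (φ.newIndep u) q :=
  (contDiffAt_base hz).comp q (contDiffAt_graphMap hu)

theorem fderiv_newIndep (hz : graphMap u q ∈ φ.dom) (hu : ContDiffAt ℝ ∞ u q) :
    fderiv ℝ (φ.newIndep u) q = φ.totalJacobian (graphMap u q) (fderiv ℝ u q) := by
  rw [newIndep_eq, totalJacobian, ← fderiv_graphMap hu.differentiableAt_of_smooth]
  exact fderiv_comp q (contDiffAt_base hz).differentiableAt_of_smooth
    (contDiffAt_graphMap hu).differentiableAt_of_smooth

/-- Where the total Jacobian does not vanish, `φ` maps the graph of `u` to a graph. -/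
theorem exists_carriesAt (hz : graphMap u q ∈ φ.dom) (hu : ContDiffAt ℝ ∞ u q)
    (hdet : (φ.totalJacobian (graphMap u q) (fderiv ℝ u q)).det ≠ 0) :
    ∃ v, φ.CarriesAt u q v := by
  have hN := contDiffAt_newIndep hz hu
  rw [← fderiv_newIndep hz hu] at hdet
  let e := (fderiv ℝ (φ.newIndep u) q).toContinuousLinearEquivOfDetNeZero hdet
  have he : HasFDerivAt (φ.newIndep u) (e : Indep n →L[ℝ] Indep n) q := by
    rw [ContinuousLinearMap.coe_toContinuousLinearEquivOfDetNeZero]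
    exact hN.differentiableAt_of_smooth.hasFDerivAt
  have hinv := hN.to_localInverse he (by simp)
  have himg := hN.localInverse_apply_image he (by simp)
  -- The inverse function theorem expresses the old independent variables through the new ones along
  -- the graph of `u`; `v` is `Ψ` on the graph in these terms.
  refine ⟨fun r => φ.Ψ (graphMap u (hN.localInverse he (by simp) r)), hz, hu, ?_, hdet, ?_⟩
  · have h1 : ContDiffAt ℝ ∞ (fun r => φ.Ψ (graphMap u r)) q :=
      (contDiffAt_Ψ hz).comp q (contDiffAt_graphMap hu)
    rw [← himg] at h1
    exact h1.comp _ hinv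
  · filter_upwards [(hN.hasStrictFDerivAt' he (by simp)).eventually_left_inverse] with r hr
    exact congrArg (fun s => φ.Ψ (graphMap u s)) hr

/-- The prolongation of `φ` to first-order derivatives. -/
theorem CarriesAt.fderiv_target (h : φ.CarriesAt u q v) (a : Indep n) :
    fderiv ℝ v (φ.newIndep u q) (φ.totalJacobian (graphMap u q) (fderiv ℝ u q) a)
      = fderiv ℝ φ.Ψ (graphMap u q) (a.1, a.2, fderiv ℝ u q a) := by
  have hz : graphMap u q ∈ φ.dom := h.mem_dom
  have hN := contDiffAt_newIndep hz h.smooth_source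
  have h1 : fderiv ℝ (fun r => v (φ.newIndep u r)) q
      = fderiv ℝ (fun r => φ.Ψ (graphMap u r)) q := Filter.EventuallyEq.fderiv_eq h.eq_near
  have h2 := fderiv_comp q h.smooth_target.differentiableAt_of_smooth
    hN.differentiableAt_of_smooth
  have h3 := fderiv_comp q (contDiffAt_Ψ hz).differentiableAt_of_smooth
    (contDiffAt_graphMap h.smooth_source).differentiableAt_of_smooth
  rw [← fderiv_newIndep hz h.smooth_source]
  have h4 := congrArg (fun A => A a) ((h2.symm.trans h1).trans h3)
  simp only [ContinuousLinearMap.comp_apply,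
    fderiv_graphMap h.smooth_source.differentiableAt_of_smooth] at h4
  exact h4

/-- The prolongation of `φ` to second-order derivatives. -/
theorem CarriesAt.fderiv_fderiv_target (h : φ.CarriesAt u q v) (a b : Indep n) :
    fderiv ℝ (fderiv ℝ v) (φ.newIndep u q)
        (φ.totalJacobian (graphMap u q) (fderiv ℝ u q) a)
        (φ.totalJacobian (graphMap u q) (fderiv ℝ u q) b)
      + fderiv ℝ v (φ.newIndep u q)
        (fderiv ℝ (fderiv ℝ φ.base) (graphMap u q) (a.1, a.2, fderiv ℝ u q a)
            (b.1, b.2, fderiv ℝ u q b)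
          + fderiv ℝ φ.base (graphMap u q) (0, 0, fderiv ℝ (fderiv ℝ u) q a b))
      = fderiv ℝ (fderiv ℝ φ.Ψ) (graphMap u q) (a.1, a.2, fderiv ℝ u q a)
            (b.1, b.2, fderiv ℝ u q b)
          + fderiv ℝ φ.Ψ (graphMap u q) (0, 0, fderiv ℝ (fderiv ℝ u) q a b) := by
  have hz : graphMap u q ∈ φ.dom := h.mem_dom
  have hu := h.smooth_source
  have hN := contDiffAt_newIndep hz hu
  have h0 : (fun r => v (φ.newIndep u r)) =ᶠ[nhds q] fun r => φ.Ψ (graphMap u r) := h.eq_near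
  have h1 := (h0.fderiv (𝕜 := ℝ)).fderiv_eq (𝕜 := ℝ)
  have h2 := fderiv_fderiv_comp h.smooth_target hN a b
  have h3 := fderiv_fderiv_comp (contDiffAt_Ψ hz) (contDiffAt_graphMap hu) a b
  have h4 := fderiv_fderiv_comp (contDiffAt_base hz) (contDiffAt_graphMap hu) a b
  rw [h1, h3, fderiv_newIndep hz hu, newIndep_eq, h4,
    fderiv_graphMap hu.differentiableAt_of_smooth, fderiv_fderiv_graphMap hu] at h2
  exact h2.symm

end PointTransformation

/-! ### Wirtinger derivatives -/

section Wirtinger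

variable {n : ℕ} {f : Vars n → ℂ} {z : Vars n}

/-- The vector of the `x_a`-axis in the space of `(t, x, ψ)`. -/
def varsAxisX (a : Fin n) : Vars n := (0, Pi.single a 1, 0)

/-- A real-linear map on `ℂ` splits into complex-linear and antilinear parts; their coefficients are
the Wirtinger derivatives. -/
theorem clm_fibre_apply (A : Vars n →L[ℝ] ℂ) (w : ℂ) :
    A (0, 0, w) = w * ((A (0, 0, 1) - Complex.I * A (0, 0, Complex.I)) / 2)
      + conj w * ((A (0, 0, 1) + Complex.I * A (0, 0, Complex.I)) / 2) := by
  have h1 : ((0, 0, w) : Vars n) = w.re • ((0, 0, 1) : Vars n)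
      + w.im • ((0, 0, Complex.I) : Vars n) := by
    simp
  have h2 : A (0, 0, w) = (w.re : ℂ) * A (0, 0, 1) + (w.im : ℂ) * A (0, 0, Complex.I) := by
    rw [h1, map_add, map_smul, map_smul]
    simp
  have h3 : conj w = w.re - w.im * Complex.I := by
    apply Complex.ext <;> simp
  rw [h2, h3]
  nth_rewrite 3 [← Complex.re_add_im w]
  linear_combination (w.im : ℂ) * A (0, 0, Complex.I) * Complex.I_sq

theorem fderiv_fibre (f : Vars n → ℂ) (z : Vars n) (w : ℂ) :
    fderiv ℝ f z (0, 0, w) = w * vdPsi f z + conj w * vdPsiBar f z :=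
  clm_fibre_apply _ w

theorem fderiv_spatial (f : Vars n → ℂ) (z : Vars n) (a : Fin n) (w : ℂ) :
    fderiv ℝ f z (0, Pi.single a 1, w) = vdX a f z + w * vdPsi f z + conj w * vdPsiBar f z := by
  rw [add_assoc, ← fderiv_fibre, vdX, ← map_add]
  simp

theorem fderiv_time (f : Vars n → ℂ) (z : Vars n) (w : ℂ) :
    fderiv ℝ f z (1, 0, w) = vdT f z + w * vdPsi f z + conj w * vdPsiBar f z := by
  rw [add_assoc, ← fderiv_fibre, vdT, ← map_add]
  simp

theorem fderiv_vdPsi (hf : ContDiffAt ℝ ∞ f z) (c : Vars n) :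
    fderiv ℝ (vdPsi f) z c = (fderiv ℝ (fderiv ℝ f) z c (0, 0, 1)
      - Complex.I * fderiv ℝ (fderiv ℝ f) z c (0, 0, Complex.I)) / 2 := by
  have hd := hf.fderiv_of_smooth.differentiableAt_of_smooth
  have h1 : ∀ e : Vars n, HasFDerivAt (fun y => fderiv ℝ f y e)
      (fderiv ℝ (fun y => fderiv ℝ f y e) z) z := fun e =>
    (hd.clm_apply (differentiableAt_const e)).hasFDerivAt
  have h2 := (((h1 (0, 0, 1)).sub ((h1 (0, 0, Complex.I)).const_mul Complex.I)).mul_const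
    (2⁻¹ : ℂ))
  have h3 : fderiv ℝ (vdPsi f) z = _ := h2.fderiv
  rw [h3]
  simp only [smul_apply, sub_apply, smul_eq_mul, hf.fderiv_fderiv_apply]
  ring

theorem fderiv_vdPsiBar (hf : ContDiffAt ℝ ∞ f z) (c : Vars n) :
    fderiv ℝ (vdPsiBar f) z c = (fderiv ℝ (fderiv ℝ f) z c (0, 0, 1)
      + Complex.I * fderiv ℝ (fderiv ℝ f) z c (0, 0, Complex.I)) / 2 := by
  have hd := hf.fderiv_of_smooth.differentiableAt_of_smooth
  have h1 : ∀ e : Vars n, HasFDerivAt (fun y => fderiv ℝ f y e)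
      (fderiv ℝ (fun y => fderiv ℝ f y e) z) z := fun e =>
    (hd.clm_apply (differentiableAt_const e)).hasFDerivAt
  have h2 := (((h1 (0, 0, 1)).add ((h1 (0, 0, Complex.I)).const_mul Complex.I)).mul_const
    (2⁻¹ : ℂ))
  have h3 : fderiv ℝ (vdPsiBar f) z = _ := h2.fderiv
  rw [h3]
  simp only [smul_apply, add_apply, smul_eq_mul, hf.fderiv_fderiv_apply]
  ring

theorem fderiv_fderiv_fibre (hf : ContDiffAt ℝ ∞ f z) (c : Vars n) (w : ℂ) :
    fderiv ℝ (fderiv ℝ f) z c (0, 0, w)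
      = w * fderiv ℝ (vdPsi f) z c + conj w * fderiv ℝ (vdPsiBar f) z c := by
  rw [clm_fibre_apply, fderiv_vdPsi hf, fderiv_vdPsiBar hf]

theorem vdPsiBar_vdPsi (hf : ContDiffAt ℝ ∞ f z) :
    vdPsiBar (vdPsi f) z = vdPsi (vdPsiBar f) z := by
  rw [vdPsiBar, vdPsi, fderiv_vdPsi hf, fderiv_vdPsi hf, fderiv_vdPsiBar hf, fderiv_vdPsiBar hf,
    hf.fderiv_fderiv_comm (0, 0, Complex.I) (0, 0, 1)]
  ring

/-- The operator `hatLaplacian` is the part of `D_a D_a` free of second derivatives of `ψ`. -/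
theorem hatLaplacian_eq (hf : ContDiffAt ℝ ∞ f z) (p : Fin n → ℂ) :
    hatLaplacian f z p = ∑ a, fderiv ℝ (fderiv ℝ f) z (0, Pi.single a 1, p a)
      (0, Pi.single a 1, p a) := by
  unfold hatLaplacian
  refine Finset.sum_congr rfl fun a _ => ?_
  have h0 : ((0, Pi.single a 1, p a) : Vars n) = varsAxisX a + (0, 0, p a) := by
    simp [varsAxisX]
  have h1 : vdX a (vdX a f) z = fderiv ℝ (fderiv ℝ f) z (varsAxisX a) (varsAxisX a) :=
    hf.fderiv_fderiv_apply _ _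
  have h2 := fderiv_fderiv_fibre hf (varsAxisX a) (p a)
  have h3 := fderiv_fderiv_fibre hf (0, 0, p a) (p a)
  rw [fderiv_fibre (vdPsi f), fderiv_fibre (vdPsiBar f), vdPsiBar_vdPsi hf] at h3
  rw [h0, map_add, map_add (fderiv ℝ (fderiv ℝ f) z), add_apply, add_apply, h3,
    hf.fderiv_fderiv_comm (0, 0, p a) (varsAxisX a), h2, h1]
  change _ + 2 * p a * fderiv ℝ (vdPsi f) z (varsAxisX a)
    + 2 * conj (p a) * fderiv ℝ (vdPsiBar f) z (varsAxisX a) + _ + _ + _ = _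
  ring

theorem fderiv_ofReal_comp {g : Vars n → ℝ} (hg : DifferentiableAt ℝ g z) (a : Vars n) :
    fderiv ℝ (fun w => (g w : ℂ)) z a = ((fderiv ℝ g z a : ℝ) : ℂ) := by
  have h := (Complex.ofRealCLM.hasFDerivAt (x := g z)).comp z hg.hasFDerivAt
  have h1 : fderiv ℝ (fun w => (g w : ℂ)) z = _ := h.fderiv
  rw [h1]
  simp

end Wirtinger

theorem fderiv_fderiv_clm_comp {E F K : Type*} [NormedAddCommGroup E] [NormedSpace ℝ E]
    [NormedAddCommGroup F] [NormedSpace ℝ F] [NormedAddCommGroup K] [NormedSpace ℝ K]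
    (A : F →L[ℝ] K) {f : E → F} {x : E} (hf : ContDiffAt ℝ ∞ f x) (a b : E) :
    fderiv ℝ (fderiv ℝ (fun y => A (f y))) x a b = A (fderiv ℝ (fderiv ℝ f) x a b) := by
  have h : fderiv ℝ (A : F → K) = fun _ => A := funext fun y => A.fderiv
  rw [fderiv_fderiv_comp A.contDiff.contDiffAt hf, h]
  simp

/-! ### Differential consequences of the conformal system -/

namespace PointTransformation

variable {n : ℕ} {φ : PointTransformation n} {z : Vars n} {H : Indep n → ℝ}

theorem fderiv_fderiv_base (hz : z ∈ φ.dom) (a b : Vars n) :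
    fderiv ℝ (fderiv ℝ φ.base) z a b = (fderiv ℝ (fderiv ℝ φ.T) z a b,
      fun c => fderiv ℝ (fderiv ℝ fun w => φ.X w c) z a b) := by
  refine Prod.ext ?_ (funext fun c => ?_)
  · exact (fderiv_fderiv_clm_comp (formT n) (contDiffAt_base hz) a b).symm
  · exact (fderiv_fderiv_clm_comp (formX c) (contDiffAt_base hz) a b).symm

theorem isOpen_indepDom (φ : PointTransformation n) : IsOpen φ.indepDom := by
  have h : φ.indepDom = (fun z : Vars n => ((z.1, z.2.1) : Indep n)) '' φ.dom := rfl
  rw [h, isOpen_iff_mem_nhds]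
  rintro _ ⟨z, hz, rfl⟩
  have hc : ContinuousAt (fun q : Indep n => ((q.1, q.2, z.2.2) : Vars n)) (z.1, z.2.1) := by
    fun_prop
  filter_upwards [hc.preimage_mem_nhds (φ.isOpen_dom.mem_nhds hz)] with q hq
  exact ⟨_, hq, rfl⟩

theorem indep_mem_indepDom (hz : z ∈ φ.dom) : (z.1, z.2.1) ∈ φ.indepDom := ⟨z, hz, rfl⟩

namespace IsConformalWith

theorem fderiv_T_fibre (h : φ.IsConformalWith H) (hz : z ∈ φ.dom) (w : ℂ) :
    fderiv ℝ φ.T z (0, 0, w) = 0 := by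
  have h1 := fderiv_fibre (fun w => (φ.T w : ℂ)) z w
  rw [h.T_psi z hz, h.T_psiBar z hz,
    fderiv_ofReal_comp (contDiffAt_T hz).differentiableAt_of_smooth] at h1
  simpa using h1

theorem fderiv_X_fibre (h : φ.IsConformalWith H) (hz : z ∈ φ.dom) (b : Fin n) (w : ℂ) :
    fderiv ℝ (fun w => φ.X w b) z (0, 0, w) = 0 := by
  have h1 := fderiv_fibre (fun w => (φ.X w b : ℂ)) z w
  rw [h.X_psi z hz, h.X_psiBar z hz,
    fderiv_ofReal_comp (contDiffAt_X_apply hz b).differentiableAt_of_smooth] at h1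
  simpa using h1

theorem fderiv_base_fibre (h : φ.IsConformalWith H) (hz : z ∈ φ.dom) (w : ℂ) :
    fderiv ℝ φ.base z (0, 0, w) = 0 := by
  rw [fderiv_base hz, h.fderiv_T_fibre hz]
  refine Prod.ext rfl (funext fun b => ?_)
  exact (fderiv_X_apply hz b _).symm.trans (h.fderiv_X_fibre hz b w)

theorem fderiv_base_spatial (h : φ.IsConformalWith H) (hz : z ∈ φ.dom) (a : Fin n) (w : ℂ) :
    fderiv ℝ φ.base z (0, Pi.single a 1, w) = ∑ b, vdX a (fun w => φ.X w b) z • axisX b := by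
  have h0 : ((0, Pi.single a 1, w) : Vars n) = (0, Pi.single a 1, 0) + (0, 0, w) := by simp
  rw [h0, map_add, h.fderiv_base_fibre hz, add_zero, fderiv_base hz,
    ← spatial_eq_sum_axisX fun b => vdX a (fun w => φ.X w b) z]
  refine Prod.ext (h.T_x z hz a) (funext fun b => ?_)
  exact (fderiv_X_apply hz b _).symm

theorem fderiv_base_time (h : φ.IsConformalWith H) (hz : z ∈ φ.dom) (w : ℂ) :
    fderiv ℝ φ.base z (1, 0, w)
      = vdT φ.T z • ((1, 0) : Indep n) + ∑ b, vdT (fun w => φ.X w b) z • axisX b := by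
  have h0 : ((1, 0, w) : Vars n) = (1, 0, 0) + (0, 0, w) := by simp
  rw [h0, map_add, h.fderiv_base_fibre hz, add_zero, fderiv_base hz,
    ← spatial_eq_sum_axisX fun b => vdT (fun w => φ.X w b) z]
  refine Prod.ext (by simp [vdT]) (funext fun b => ?_)
  simp only [Prod.smul_mk, smul_zero, Prod.mk_add_mk, zero_add]
  exact (fderiv_X_apply hz b _).symm

theorem fderiv_fderiv_T (h : φ.IsConformalWith H) (hz : z ∈ φ.dom) (a : Fin n) (w : ℂ)
    (c : Vars n) : fderiv ℝ (fderiv ℝ φ.T) z c (0, Pi.single a 1, w) = 0 := by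
  have hev : (fun y => fderiv ℝ φ.T y (0, Pi.single a 1, w)) =ᶠ[nhds z] fun _ => 0 := by
    filter_upwards [φ.isOpen_dom.mem_nhds hz] with y hy
    have h0 : ((0, Pi.single a 1, w) : Vars n) = (0, Pi.single a 1, 0) + (0, 0, w) := by simp
    rw [h0, map_add, h.fderiv_T_fibre hy, add_zero]
    exact h.T_x y hy a
  rw [← (contDiffAt_T hz).fderiv_fderiv_apply, hev.fderiv_eq]
  simp

theorem fderiv_fderiv_X_fibre (h : φ.IsConformalWith H) (hz : z ∈ φ.dom) (b : Fin n) (w : ℂ)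
    (c : Vars n) : fderiv ℝ (fderiv ℝ fun w => φ.X w b) z c (0, 0, w) = 0 := by
  have hev : (fun y => fderiv ℝ (fun w => φ.X w b) y (0, 0, w)) =ᶠ[nhds z] fun _ => 0 := by
    filter_upwards [φ.isOpen_dom.mem_nhds hz] with y hy
    exact h.fderiv_X_fibre hy b w
  rw [← (contDiffAt_X_apply hz b).fderiv_fderiv_apply, hev.fderiv_eq]
  simp

/-- `T_a` and the fibre derivatives of `X` vanish identically on an open set, so all second
derivatives involving them vanish and `w` drops out. -/
theorem fderiv_fderiv_base_spatial (h : φ.IsConformalWith H) (hz : z ∈ φ.dom) (a : Fin n)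
    (w : ℂ) : fderiv ℝ (fderiv ℝ φ.base) z (0, Pi.single a 1, w) (0, Pi.single a 1, w)
      = ∑ b, fderiv ℝ (fderiv ℝ fun w => φ.X w b) z (varsAxisX a) (varsAxisX a) • axisX b := by
  rw [fderiv_fderiv_base hz, h.fderiv_fderiv_T hz, ← spatial_eq_sum_axisX fun b =>
    fderiv ℝ (fderiv ℝ fun w => φ.X w b) z (varsAxisX a) (varsAxisX a)]
  refine Prod.ext rfl (funext fun b => ?_)
  have h0 : ((0, Pi.single a 1, w) : Vars n) = varsAxisX a + (0, 0, w) := by simp [varsAxisX]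
  change fderiv ℝ (fderiv ℝ fun w => φ.X w b) z _ _ = _
  rw [h0, map_add, h.fderiv_fderiv_X_fibre hz, add_zero,
    (contDiffAt_X_apply hz b).fderiv_fderiv_comm, map_add, h.fderiv_fderiv_X_fibre hz, add_zero]

/-- A one-sided inverse of a square matrix is two-sided, so `M Mᵀ = H` gives `Mᵀ M = H`. The form
contracted over the index of `X` is the one whose differentiation yields the Laplacian of `X`. -/
theorem conformal_transpose (h : φ.IsConformalWith H) (hz : z ∈ φ.dom) (a c : Fin n) :
    ∑ b, vdX a (fun w => φ.X w b) z * vdX c (fun w => φ.X w b) z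
      = if a = c then H (z.1, z.2.1) else 0 := by
  let M : Matrix (Fin n) (Fin n) ℝ := fun b a => vdX a (fun w => φ.X w b) z
  have hH : H (z.1, z.2.1) ≠ 0 := (h.H_pos _ (indep_mem_indepDom hz)).ne'
  have h1 : M * ((H (z.1, z.2.1))⁻¹ • M.transpose) = 1 := by
    ext b c
    have h2 := h.conformal z hz b c
    rw [Matrix.mul_smul, Matrix.smul_apply, Matrix.mul_apply, Matrix.one_apply]
    change _ • (∑ a, vdX a (fun w => φ.X w b) z * vdX a (fun w => φ.X w c) z) = _
    rw [h2]
    split_ifs <;> simp [hH]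
  have h2 : ((H (z.1, z.2.1))⁻¹ • M.transpose) * M = 1 := mul_eq_one_comm.1 h1
  have h3 := congrFun (congrFun h2 a) c
  rw [Matrix.smul_mul, Matrix.smul_apply, Matrix.mul_apply, Matrix.one_apply, smul_eq_mul,
    inv_mul_eq_iff_eq_mul₀ hH] at h3
  change ∑ b, vdX a (fun w => φ.X w b) z * vdX c (fun w => φ.X w b) z = _ at h3
  rw [h3]
  split_ifs <;> simp

theorem fderiv_conformal_transpose (h : φ.IsConformalWith H) (hz : z ∈ φ.dom) (a c d : Fin n) :
    ∑ b, (fderiv ℝ (fderiv ℝ fun w => φ.X w b) z (varsAxisX d) (varsAxisX a)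
          * vdX c (fun w => φ.X w b) z
        + vdX a (fun w => φ.X w b) z
          * fderiv ℝ (fderiv ℝ fun w => φ.X w b) z (varsAxisX d) (varsAxisX c))
      = if a = c then pdX d H (z.1, z.2.1) else 0 := by
  have hev : (fun y => ∑ b, vdX a (fun w => φ.X w b) y * vdX c (fun w => φ.X w b) y)
      =ᶠ[nhds z] fun y => if a = c then H (y.1, y.2.1) else 0 := by
    filter_upwards [φ.isOpen_dom.mem_nhds hz] with y hy
    exact h.conformal_transpose hy a c
  have hd : ∀ b a, DifferentiableAt ℝ (fun y => vdX a (fun w => φ.X w b) y) z := fun b a =>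
    (contDiffAt_X_apply hz b).fderiv_of_smooth.differentiableAt_of_smooth.clm_apply
      (differentiableAt_const _)
  have h1 := HasFDerivAt.fun_sum (u := Finset.univ)
    (fun b _ => (hd b a).hasFDerivAt.mul (hd b c).hasFDerivAt)
  have h2 := congrArg (fun A => A (varsAxisX d)) (h1.fderiv.symm.trans hev.fderiv_eq)
  have hX : ∀ b a, fderiv ℝ (fun y => vdX a (fun w => φ.X w b) y) z (varsAxisX d)
      = fderiv ℝ (fderiv ℝ fun w => φ.X w b) z (varsAxisX d) (varsAxisX a) := fun b a =>
    (contDiffAt_X_apply hz b).fderiv_fderiv_apply _ _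
  simp only [sum_apply, add_apply, smul_apply, smul_eq_mul, hX] at h2
  have h3 : fderiv ℝ (fun y : Vars n => if a = c then H (y.1, y.2.1) else 0) z (varsAxisX d)
      = if a = c then pdX d H (z.1, z.2.1) else 0 := by
    split_ifs
    · have hH : DifferentiableAt ℝ H (z.1, z.2.1) :=
        (h.smooth_H.contDiffAt
          (φ.isOpen_indepDom.mem_nhds (indep_mem_indepDom hz))).differentiableAt_of_smooth
      let π : Vars n →L[ℝ] Indep n := (ContinuousLinearMap.fst ℝ ℝ ((Fin n → ℝ) × ℂ)).prod
        ((ContinuousLinearMap.fst ℝ (Fin n → ℝ) ℂ).comp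
          (ContinuousLinearMap.snd ℝ ℝ ((Fin n → ℝ) × ℂ)))
      have h4 : HasFDerivAt (fun y => H (π y)) ((fderiv ℝ H (z.1, z.2.1)).comp π) z :=
        HasFDerivAt.comp z (g := H) (f := π) hH.hasFDerivAt π.hasFDerivAt
      change fderiv ℝ (fun y => H (π y)) z _ = _
      rw [h4.fderiv]
      rfl
    · simp
  rw [← h3, ← h2]
  exact Finset.sum_congr rfl fun b _ => by ring

/-- Conformality determines the spatial Laplacian of `X`. -/
theorem sum_laplacian_X_mul (h : φ.IsConformalWith H) (hz : z ∈ φ.dom) (c : Fin n) :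
    ∑ b, (∑ a, fderiv ℝ (fderiv ℝ fun w => φ.X w b) z (varsAxisX a) (varsAxisX a))
      * vdX c (fun w => φ.X w b) z = -(((n : ℝ) - 2) / 2) * pdX c H (z.1, z.2.1) := by
  set D := fun (b a c : Fin n) =>
    fderiv ℝ (fderiv ℝ fun w => φ.X w b) z (varsAxisX a) (varsAxisX c) with hD
  set M := fun (b a : Fin n) => vdX a (fun w => φ.X w b) z with hM
  have hsym : ∀ b a c, D b a c = D b c a := fun b a c =>
    (contDiffAt_X_apply hz b).fderiv_fderiv_comm _ _
  -- Differentiate `X^b_a X^b_c = H δ_ac` along `x_a`. In `h2`, the relation `X^b_a X^b_a = H` (no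
  -- sum over `a`) is differentiated along `x_c`. Summing both over `a` leaves `H_c - (n / 2) H_c`.
  have h1 : ∀ a, ∑ b, D b a a * M b c + ∑ b, M b a * D b a c
      = if a = c then pdX a H (z.1, z.2.1) else 0 := fun a => by
    rw [← Finset.sum_add_distrib]
    exact h.fderiv_conformal_transpose hz a c a
  have h2 : ∀ a, 2 * ∑ b, M b a * D b a c = pdX c H (z.1, z.2.1) := fun a => by
    have h3 := h.fderiv_conformal_transpose hz a a c
    rw [if_pos rfl] at h3
    rw [← h3, Finset.mul_sum]
    refine Finset.sum_congr rfl fun b _ => ?_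
    rw [hsym b a c]
    simp only [hD, hM]
    ring
  have h3 : ∑ a, (∑ b, D b a a * M b c + ∑ b, M b a * D b a c) = pdX c H (z.1, z.2.1) := by
    simp [h1]
  have h4 : ∑ a, 2 * ∑ b, M b a * D b a c = n * pdX c H (z.1, z.2.1) := by
    simp [h2]
  rw [Finset.sum_add_distrib] at h3
  rw [← Finset.mul_sum] at h4
  simp only [Finset.sum_mul]
  rw [Finset.sum_comm]
  change ∑ a, ∑ b, D b a a * M b c = _
  linarith

end IsConformalWith

end PointTransformation

/-! ### Transformation of equations under conformal transformations -/

namespace PointTransformation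

variable {n : ℕ} {φ : PointTransformation n} {H : Indep n → ℝ} {u v : Indep n → ℂ} {q : Indep n}

theorem totalJacobian_axisX (h : φ.IsConformalWith H) {z : Vars n} (hz : z ∈ φ.dom)
    (p : Indep n →L[ℝ] ℂ) (a : Fin n) :
    φ.totalJacobian z p (axisX a) = ∑ b, vdX a (fun w => φ.X w b) z • axisX b :=
  h.fderiv_base_spatial hz a _

namespace CarriesAt

/-- The chain rule `X^b_a ψ̃_b = D_a Ψ`; conformality inverts it in `pdX_target`. -/
theorem sum_vdX_mul_pdX (h : φ.CarriesAt u q v) (hc : φ.IsConformalWith H) (a : Fin n) :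
    ∑ b, ((vdX a (fun w => φ.X w b) (graphMap u q) : ℝ) : ℂ) * pdX b v (φ.newIndep u q)
      = totalDX a φ.Ψ (graphMap u q) (fun a => pdX a u q) := by
  have h1 := h.fderiv_target (axisX a)
  rw [totalJacobian_axisX hc (show graphMap u q ∈ φ.dom from h.mem_dom), map_sum] at h1
  simp only [map_smul, Complex.real_smul] at h1
  exact h1.trans (fderiv_spatial _ _ _ _)

theorem pdX_target (h : φ.CarriesAt u q v) (hc : φ.IsConformalWith H) (b : Fin n) :
    pdX b v (φ.newIndep u q) = ∑ a, ((vdX a (fun w => φ.X w b) (graphMap u q) / H q : ℝ) : ℂ)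
      * totalDX a φ.Ψ (graphMap u q) (fun a => pdX a u q) := by
  have hz : graphMap u q ∈ φ.dom := h.mem_dom
  have hH : H q ≠ 0 := (hc.H_pos _ (indep_mem_indepDom hz)).ne'
  simp only [← h.sum_vdX_mul_pdX hc, Finset.mul_sum]
  rw [Finset.sum_comm]
  have h1 : ∀ c, ∑ a, ((vdX a (fun w => φ.X w b) (graphMap u q) / H q : ℝ) : ℂ)
      * (((vdX a (fun w => φ.X w c) (graphMap u q) : ℝ) : ℂ) * pdX c v (φ.newIndep u q))
      = if b = c then pdX c v (φ.newIndep u q) else 0 := by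
    intro c
    have h2 := hc.conformal _ hz b c
    have h3 : ∑ a, ((vdX a (fun w => φ.X w b) (graphMap u q) / H q : ℝ) : ℂ)
        * (((vdX a (fun w => φ.X w c) (graphMap u q) : ℝ) : ℂ) * pdX c v (φ.newIndep u q))
        = ((∑ a, vdX a (fun w => φ.X w b) (graphMap u q)
          * vdX a (fun w => φ.X w c) (graphMap u q) : ℝ) : ℂ) / H q
            * pdX c v (φ.newIndep u q) := by
      rw [Complex.ofReal_sum, Finset.sum_div, Finset.sum_mul]
      refine Finset.sum_congr rfl fun a _ => ?_
      push_cast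
      ring
    rw [h3, h2]
    split_ifs
    · have hH' : (H q : ℂ) ≠ 0 := by exact_mod_cast hH
      change (H q : ℂ) / H q * _ = _
      rw [div_self hH', one_mul]
    · simp
  simp only [h1]
  simp

theorem gradJet_target (h : φ.CarriesAt u q v) (hc : φ.IsConformalWith H) :
    gradJet v (φ.newIndep u q)
      = φ.newGradVars H (graphMap u q) (fun a => pdX a u q) := by
  refine Prod.ext ?_ (funext fun b => h.pdX_target hc b)
  have h1 : v (φ.newIndep u q) = φ.Ψ (graphMap u q) := h.eq_near.self_of_nhds
  simp only [gradJet, newGradVars, toMap, h1]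
  rfl

theorem vdT_mul_pdT (h : φ.CarriesAt u q v) (hc : φ.IsConformalWith H) :
    ((vdT φ.T (graphMap u q) : ℝ) : ℂ) * pdT v (φ.newIndep u q)
      = vdT φ.Ψ (graphMap u q) + pdT u q * vdPsi φ.Ψ (graphMap u q)
        + conj (pdT u q) * vdPsiBar φ.Ψ (graphMap u q)
        - ∑ b, ∑ a, ((vdT (fun w => φ.X w b) (graphMap u q)
          * vdX a (fun w => φ.X w b) (graphMap u q) / H q : ℝ) : ℂ)
            * totalDX a φ.Ψ (graphMap u q) (fun a => pdX a u q) := by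
  have hz : graphMap u q ∈ φ.dom := h.mem_dom
  have h1 := h.fderiv_target (1, 0)
  rw [totalJacobian_apply, hc.fderiv_base_time hz, map_add, map_sum, fderiv_time] at h1
  simp only [map_smul, Complex.real_smul] at h1
  have h2 : ∑ b, ((vdT (fun w => φ.X w b) (graphMap u q) : ℝ) : ℂ) * pdX b v (φ.newIndep u q)
      = ∑ b, ∑ a, ((vdT (fun w => φ.X w b) (graphMap u q)
          * vdX a (fun w => φ.X w b) (graphMap u q) / H q : ℝ) : ℂ)
            * totalDX a φ.Ψ (graphMap u q) (fun a => pdX a u q) := by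
    refine Finset.sum_congr rfl fun b _ => ?_
    rw [h.pdX_target hc, Finset.mul_sum]
    refine Finset.sum_congr rfl fun a _ => ?_
    push_cast
    ring
  rw [← h2]
  exact eq_sub_of_add_eq h1

theorem pdX_pdX_source (h : φ.CarriesAt u q v) (a : Fin n) :
    fderiv ℝ (fderiv ℝ u) q (axisX a) (axisX a) = pdX a (pdX a u) q :=
  (h.smooth_source.fderiv_fderiv_apply _ _).symm

theorem pdX_pdX_target (h : φ.CarriesAt u q v) (a : Fin n) :
    fderiv ℝ (fderiv ℝ v) (φ.newIndep u q) (axisX a) (axisX a)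
      = pdX a (pdX a v) (φ.newIndep u q) :=
  (h.smooth_target.fderiv_fderiv_apply _ _).symm

/-- Trace of the second-order chain rule over spatial axes. Conformality turns the Hessian term into
`H` times the new Laplacian (`hA`), and the gradient paired with the Laplacian of `X` gives the `(n
- 2) / 2` term (`hB`). -/
theorem mul_laplacian_target (h : φ.CarriesAt u q v) (hc : φ.IsConformalWith H) :
    (H q : ℂ) * ∑ b, pdX b (pdX b v) (φ.newIndep u q)
      = hatLaplacian φ.Ψ (graphMap u q) (fun a => pdX a u q)
        + ((n : ℂ) - 2) / 2 * ∑ a, ((pdX a H q / H q : ℝ) : ℂ)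
          * totalDX a φ.Ψ (graphMap u q) (fun a => pdX a u q)
        + (∑ a, pdX a (pdX a u) q) * vdPsi φ.Ψ (graphMap u q)
        + conj (∑ a, pdX a (pdX a u) q) * vdPsiBar φ.Ψ (graphMap u q) := by
  have hz : graphMap u q ∈ φ.dom := h.mem_dom
  have h1 : ∑ a, _ = ∑ a, _ :=
    Finset.sum_congr rfl fun a (_ : a ∈ Finset.univ) => h.fderiv_fderiv_target (axisX a) (axisX a)
  simp only [Finset.sum_add_distrib, map_add, hc.fderiv_base_fibre hz, map_zero,
    totalJacobian_axisX hc hz] at h1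
  have hA : ∑ a, fderiv ℝ (fderiv ℝ v) (φ.newIndep u q)
        (∑ b, vdX a (fun w => φ.X w b) (graphMap u q) • axisX b)
        (∑ b, vdX a (fun w => φ.X w b) (graphMap u q) • axisX b)
      = (H q : ℂ) * ∑ b, pdX b (pdX b v) (φ.newIndep u q) := by
    simp only [map_sum, map_smul, sum_apply, smul_apply, Complex.real_smul, Finset.mul_sum]
    rw [Finset.sum_comm]
    have h2 : ∀ b c, ∑ a, ((vdX a (fun w => φ.X w b) (graphMap u q) : ℝ) : ℂ)
        * (((vdX a (fun w => φ.X w c) (graphMap u q) : ℝ) : ℂ)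
          * fderiv ℝ (fderiv ℝ v) (φ.newIndep u q) (axisX c) (axisX b))
        = if b = c then (H q : ℂ) * pdX b (pdX b v) (φ.newIndep u q) else 0 := by
      intro b c
      have h3 := hc.conformal _ hz b c
      simp only [← mul_assoc, ← Finset.sum_mul]
      have h4 : ∑ a, ((vdX a (fun w => φ.X w b) (graphMap u q) : ℝ) : ℂ)
          * ((vdX a (fun w => φ.X w c) (graphMap u q) : ℝ) : ℂ)
          = ((if b = c then H q else 0 : ℝ) : ℂ) := by
        rw [← show _ = (if b = c then H q else 0) from h3]
        push_cast
        rfl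
      rw [h4]
      split_ifs with hbc
      · subst hbc
        rw [h.pdX_pdX_target]
      · simp
    refine Finset.sum_congr rfl fun b _ => ?_
    rw [Finset.sum_comm]
    simp [h2]
  have hB : ∑ a, fderiv ℝ v (φ.newIndep u q) (fderiv ℝ (fderiv ℝ φ.base) (graphMap u q)
        ((axisX a).1, (axisX a).2, fderiv ℝ u q (axisX a))
        ((axisX a).1, (axisX a).2, fderiv ℝ u q (axisX a)))
      = -(((n : ℂ) - 2) / 2 * ∑ a, ((pdX a H q / H q : ℝ) : ℂ)
          * totalDX a φ.Ψ (graphMap u q) (fun a => pdX a u q)) := by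
    have h2 : ∀ a, fderiv ℝ (fderiv ℝ φ.base) (graphMap u q)
        ((axisX a).1, (axisX a).2, fderiv ℝ u q (axisX a))
        ((axisX a).1, (axisX a).2, fderiv ℝ u q (axisX a)) = _ := fun a =>
      hc.fderiv_fderiv_base_spatial hz a (fderiv ℝ u q (axisX a))
    simp only [h2, map_sum, map_smul, Complex.real_smul]
    rw [Finset.sum_comm]
    simp only [← Finset.sum_mul, ← Complex.ofReal_sum]
    have h3 : ∀ b, fderiv ℝ v (φ.newIndep u q) (axisX b) = _ := h.pdX_target hc
    simp only [h3, Finset.mul_sum]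
    rw [Finset.sum_comm, ← Finset.sum_neg_distrib]
    refine Finset.sum_congr rfl fun c _ => ?_
    have h4 := hc.sum_laplacian_X_mul hz c
    have h5 : (((n : ℂ) - 2) / 2 : ℂ) = (((n : ℝ) - 2) / 2 : ℝ) := by push_cast; rfl
    rw [h5, ← mul_assoc, ← neg_mul, ← Complex.ofReal_mul, ← Complex.ofReal_neg]
    have h6 : -(((n : ℝ) - 2) / 2 * (pdX c H q / H q))
        = (∑ b, (∑ a, fderiv ℝ (fderiv ℝ fun w => φ.X w b) (graphMap u q) (varsAxisX a)
          (varsAxisX a)) * vdX c (fun w => φ.X w b) (graphMap u q)) / H q := by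
      rw [h4]
      change _ = -(((n : ℝ) - 2) / 2) * pdX c H q / H q
      ring
    rw [h6, Finset.sum_div, Complex.ofReal_sum, Finset.sum_mul]
    refine Finset.sum_congr rfl fun b _ => ?_
    push_cast
    ring
  have hC : ∑ a, fderiv ℝ φ.Ψ (graphMap u q) (0, 0, fderiv ℝ (fderiv ℝ u) q (axisX a) (axisX a))
      = (∑ a, pdX a (pdX a u) q) * vdPsi φ.Ψ (graphMap u q)
        + conj (∑ a, pdX a (pdX a u) q) * vdPsiBar φ.Ψ (graphMap u q) := by
    simp only [h.pdX_pdX_source, fderiv_fibre, Finset.sum_add_distrib, map_sum, Finset.sum_mul]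
  have hD : hatLaplacian φ.Ψ (graphMap u q) (fun a => pdX a u q) = ∑ a, _ :=
    hatLaplacian_eq (contDiffAt_Ψ hz) _
  rw [hA, hB, hC] at h1
  have h1' : (H q : ℂ) * ∑ b, pdX b (pdX b v) (φ.newIndep u q)
      + (-(((n : ℂ) - 2) / 2 * ∑ a, ((pdX a H q / H q : ℝ) : ℂ)
          * totalDX a φ.Ψ (graphMap u q) (fun a => pdX a u q)) + ∑ a : Fin n, 0)
      = hatLaplacian φ.Ψ (graphMap u q) (fun a => pdX a u q)
        + ((∑ a, pdX a (pdX a u) q) * vdPsi φ.Ψ (graphMap u q)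
        + conj (∑ a, pdX a (pdX a u) q) * vdPsiBar φ.Ψ (graphMap u q)) := by
    rw [hD]
    exact h1
  rw [Finset.sum_const_zero] at h1'
  linear_combination h1'

/-- The left-hand side of the transformed equation in terms of the original derivatives. -/
theorem transformed_equation (h : φ.CarriesAt u q v) (hc : φ.IsConformalWith H)
    (F : GradVars n → ℂ) (g f : ℂ) :
    ((vdT φ.T (graphMap u q) : ℝ) : ℂ) * (Complex.I * pdT v (φ.newIndep u q)
        + g * ∑ b, pdX b (pdX b v) (φ.newIndep u q) + f)
      = vdPsi φ.Ψ (graphMap u q) * (Complex.I * pdT u q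
          + g * vdT φ.T (graphMap u q) / H q * (∑ a, pdX a (pdX a u) q) + F (gradJet u q))
        - vdPsiBar φ.Ψ (graphMap u q) * conj (Complex.I * pdT u q
          + -conj (g * vdT φ.T (graphMap u q) / H q) * (∑ a, pdX a (pdX a u) q)
          + F (gradJet u q))
        + vdT φ.T (graphMap u q) * (f - φ.newF H F g (graphMap u q) (fun a => pdX a u q)) := by
  have hz : graphMap u q ∈ φ.dom := h.mem_dom
  have hH : (H q : ℂ) ≠ 0 := by
    exact_mod_cast (hc.H_pos _ (indep_mem_indepDom hz)).ne'
  have hT : ((vdT φ.T (graphMap u q) : ℝ) : ℂ) ≠ 0 := by exact_mod_cast hc.T_t _ hz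
  have h1 := h.vdT_mul_pdT hc
  have h2 := h.mul_laplacian_target hc
  have h3 : gradJet u q = (graphMap u q, fun a => pdX a u q) := rfl
  have h4 : H ((graphMap u q).1, (graphMap u q).2.1) = H q := rfl
  have h5 : ∀ a, pdX a H ((graphMap u q).1, (graphMap u q).2.1) = pdX a H q := fun a => rfl
  simp only [newF, h3, h4, h5, map_add, map_mul, map_neg, map_div₀, Complex.conj_conj,
    Complex.conj_ofReal, Complex.conj_I]
  have h6 : ∑ b, pdX b (pdX b v) (φ.newIndep u q) = (H q : ℂ)⁻¹ * _ :=
    (eq_inv_mul_iff_mul_eq₀ hH).2 h2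
  have h7 : pdT v (φ.newIndep u q) = ((vdT φ.T (graphMap u q) : ℝ) : ℂ)⁻¹ * _ :=
    (eq_inv_mul_iff_mul_eq₀ hT).2 h1
  rw [h6, h7]
  generalize hatLaplacian φ.Ψ (graphMap u q) (fun a => pdX a u q) = e1
  generalize ∑ b, ∑ a, ((vdT (fun w => φ.X w b) (graphMap u q)
          * vdX a (fun w => φ.X w b) (graphMap u q) / H q : ℝ) : ℂ)
            * totalDX a φ.Ψ (graphMap u q) (fun a => pdX a u q) = e2
  generalize ∑ a, ((pdX a H q / H q : ℝ) : ℂ)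
          * totalDX a φ.Ψ (graphMap u q) (fun a => pdX a u q) = e3
  generalize conj (∑ a, pdX a (pdX a u) q) = e4
  generalize ((vdT φ.T (graphMap u q) : ℝ) : ℂ) = τ at *
  field_simp
  ring

end CarriesAt

/-- Conformal transformations act on `ψ` by local diffeomorphisms. -/
theorem IsConformalWith.eq_zero_of_wirtinger (hc : φ.IsConformalWith H) {z : Vars n}
    (hz : z ∈ φ.dom) {w : ℂ}
    (h : vdPsi φ.Ψ z * w - vdPsiBar φ.Ψ z * conj w = 0) : w = 0 := by
  -- Multiplying by `i` turns the minus sign into a plus, because `(i w)* = -i w*`; the expression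
  -- becomes the fibre derivative of `Ψ` along `i w`.
  have h1 : fderiv ℝ φ.Ψ z (0, 0, Complex.I * w) = 0 := by
    rw [fderiv_fibre, map_mul, Complex.conj_I]
    linear_combination Complex.I * h
  have h2 := eq_zero_of_fderiv_eq_zero hz (hc.fderiv_base_fibre hz _) h1
  have h3 : Complex.I * w = 0 := congrArg (fun v : Vars n => v.2.2) h2
  simpa using h3

/-- The sufficiency of the conditions on the arbitrary elements. -/
theorem isAdmissible_of_conformal (hc : φ.IsConformalWith H) {L : ClassN n φ.dom}
    {L' : ClassN n φ.image}
    (h : ∀ z ∈ φ.dom, ∀ p : Fin n → ℂ,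
      (vdPsi φ.Ψ z ≠ 0 → L'.G (φ.newGradVars H z p)
        = ((H (z.1, z.2.1) / vdT φ.T z : ℝ) : ℂ) * L.G (z, p)) ∧
      (vdPsiBar φ.Ψ z ≠ 0 → L'.G (φ.newGradVars H z p)
        = ((H (z.1, z.2.1) / vdT φ.T z : ℝ) : ℂ) * -conj (L.G (z, p))) ∧
      L'.F (φ.newGradVars H z p) = φ.newF H L.F (L'.G (φ.newGradVars H z p)) z p) :
    φ.IsAdmissible L L' := by
  intro u q v hcar
  have hz : graphMap u q ∈ φ.dom := hcar.mem_dom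
  have hH : (H q : ℂ) ≠ 0 := by
    exact_mod_cast (hc.H_pos _ (indep_mem_indepDom hz)).ne'
  have hT : ((vdT φ.T (graphMap u q) : ℝ) : ℂ) ≠ 0 := by exact_mod_cast hc.T_t _ hz
  obtain ⟨h1, h2, h3⟩ := h _ hz fun a => pdX a u q
  have h4 : H ((graphMap u q).1, (graphMap u q).2.1) = H q := rfl
  rw [h4] at h1 h2
  have h5 : (graphMap u q, fun a => pdX a u q) = gradJet u q := rfl
  rw [h5] at h1 h2
  set g := L'.G (φ.newGradVars H (graphMap u q) fun a => pdX a u q) with hg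
  have key := hcar.transformed_equation hc L.F g
    (L'.F (φ.newGradVars H (graphMap u q) fun a => pdX a u q))
  rw [h3, sub_self, mul_zero, add_zero] at key
  -- Multiplied by the Wirtinger derivative, each conditional formula for `G̃` becomes
  -- unconditional.
  have e1 : vdPsi φ.Ψ (graphMap u q) * (g * vdT φ.T (graphMap u q) / H q)
      = vdPsi φ.Ψ (graphMap u q) * L.G (gradJet u q) := by
    by_cases h0 : vdPsi φ.Ψ (graphMap u q) = 0
    · simp [h0]
    · rw [h1 h0]
      push_cast
      field_simp
  have e2 : vdPsiBar φ.Ψ (graphMap u q) * (g * vdT φ.T (graphMap u q) / H q)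
      = vdPsiBar φ.Ψ (graphMap u q) * -conj (L.G (gradJet u q)) := by
    by_cases h0 : vdPsiBar φ.Ψ (graphMap u q) = 0
    · simp [h0]
    · rw [h2 h0]
      push_cast
      field_simp
  have key2 : ((vdT φ.T (graphMap u q) : ℝ) : ℂ) * (Complex.I * pdT v (φ.newIndep u q)
        + g * ∑ b, pdX b (pdX b v) (φ.newIndep u q)
        + φ.newF H L.F g (graphMap u q) fun a => pdX a u q)
      = vdPsi φ.Ψ (graphMap u q) * (Complex.I * pdT u q
          + L.G (gradJet u q) * (∑ a, pdX a (pdX a u) q) + L.F (gradJet u q))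
        - vdPsiBar φ.Ψ (graphMap u q) * conj (Complex.I * pdT u q
          + L.G (gradJet u q) * (∑ a, pdX a (pdX a u) q) + L.F (gradJet u q)) := by
    rw [key]
    simp only [map_add, map_mul, map_neg, Complex.conj_conj]
    linear_combination (∑ a, pdX a (pdX a u) q) * e1 + conj (∑ a, pdX a (pdX a u) q) * e2
  unfold ClassN.HoldsAt
  rw [hcar.gradJet_target hc, h3, ← hg]
  constructor
  · intro hE
    rw [hE] at key2
    simpa [hT] using key2
  · intro hE
    rw [hE, mul_zero] at key2
    exact hc.eq_zero_of_wirtinger hz key2.symm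

end PointTransformation

/-! ### Necessity: the form of admissible transformations -/

namespace PointTransformation

variable {n : ℕ} {φ : PointTransformation n} {z : Vars n} {L : ClassN n φ.dom}
  {L' : ClassN n φ.image}

/-- At a fixed first-order jet, the transformed equation is an affine condition on the trace of
the pullback of the second derivatives along the inverse of the total Jacobian. -/
theorem exists_affine_condition (L' : ClassN n φ.image) (hz : z ∈ φ.dom) (p : Indep n →L[ℝ] ℂ)
    (hdet : (φ.totalJacobian z p).det ≠ 0) :
    ∃ (k : ℂ) (l : ℂ →L[ℝ] ℂ), Function.Injective l ∧
      ∀ B : Indep n →L[ℝ] Indep n →L[ℝ] ℂ, (∀ a b, B a b = B b a) →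
        ∃ v, φ.CarriesAt (quadraticAt (z.1, z.2.1) z.2.2 p B) (z.1, z.2.1) v ∧
          (L'.HoldsAt v (φ.newIndep (quadraticAt (z.1, z.2.1) z.2.2 p B) (z.1, z.2.1)) ↔
            k + l (∑ b,
              B (((φ.totalJacobian z p).toContinuousLinearEquivOfDetNeZero hdet).symm (axisX b))
                (((φ.totalJacobian z p).toContinuousLinearEquivOfDetNeZero hdet).symm (axisX b)))
              = 0) := by
  set N := (φ.totalJacobian z p).toContinuousLinearEquivOfDetNeZero hdet with hN
  have hNN : ∀ y, φ.totalJacobian z p (N.symm y) = y := fun y => by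
    rw [← (φ.totalJacobian z p).toContinuousLinearEquivOfDetNeZero_apply hdet, ← hN]
    simp
  set q : Indep n := (z.1, z.2.1) with hq
  -- `V` is the derivative of `v` forced by the first-order jet; `l0` measures how a second
  -- derivative of `u` enters that of `v`. Neither depends on `B`.
  let V : Indep n →L[ℝ] ℂ :=
    ((fderiv ℝ φ.Ψ z).comp (graphCLM p)).comp (N.symm : Indep n →L[ℝ] Indep n)
  let l0 : ℂ →L[ℝ] ℂ := (fderiv ℝ φ.Ψ z - V.comp (fderiv ℝ φ.base z)).comp (fibreCLM n)
  let γ : GradVars n := ((φ.T z, φ.X z, φ.Ψ z), fun a => V (axisX a))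
  have hγ : L'.G γ ≠ 0 := L'.G_ne_zero _ ⟨z, hz, rfl⟩ _
  let S : ℂ := ∑ b, (fderiv ℝ (fderiv ℝ φ.Ψ) z (graphCLM p (N.symm (axisX b)))
      (graphCLM p (N.symm (axisX b)))
    - V (fderiv ℝ (fderiv ℝ φ.base) z (graphCLM p (N.symm (axisX b)))
      (graphCLM p (N.symm (axisX b)))))
  -- If `l0 w = 0`, the vertical vector `(0, 0, w)` and a vector tangent to the graph have the same
  -- image under the derivative of `φ`, so they coincide, which forces `w = 0`.
  have hl0 : ∀ w, l0 w = 0 → w = 0 := by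
    intro w hw
    have h1 : fderiv ℝ φ.Ψ z (0, 0, w) - V (fderiv ℝ φ.base z (0, 0, w)) = 0 := hw
    set r := N.symm (fderiv ℝ φ.base z (0, 0, w)) with hr
    have h2 : fderiv ℝ φ.base z (graphCLM p r) = fderiv ℝ φ.base z (0, 0, w) := hNN _
    have h3 : ((0, 0, w) : Vars n) - graphCLM p r = 0 := by
      apply eq_zero_of_fderiv_eq_zero hz
      · rw [map_sub, h2, sub_self]
      · rw [map_sub]
        exact h1
    have h4 : (0, 0, w) = ((r.1, r.2, p r) : Vars n) := sub_eq_zero.1 h3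
    simp only [Prod.mk.injEq] at h4
    have h5 : r = 0 := Prod.ext h4.1.symm h4.2.1.symm
    rw [h4.2.2, h5, map_zero]
  refine ⟨Complex.I * V (1, 0) + L'.G γ * S + L'.F γ, L'.G γ • l0, ?_, ?_⟩
  · rw [injective_iff_map_eq_zero]
    intro w hw
    have h1 : L'.G γ * l0 w = 0 := hw
    exact hl0 w ((mul_eq_zero.1 h1).resolve_left hγ)
  · intro B hB
    set u := quadraticAt q z.2.2 p B with hu
    have hgr : graphMap u q = z := by simp [graphMap, hu, hq]
    have hsm : ContDiffAt ℝ ∞ u q := (contDiff_quadraticAt q z.2.2 p B).contDiffAt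
    have hp : fderiv ℝ u q = p := fderiv_quadraticAt_self q z.2.2 p hB
    have hBB : fderiv ℝ (fderiv ℝ u) q = B := fderiv_fderiv_quadraticAt q z.2.2 p hB
    obtain ⟨v, hv⟩ := exists_carriesAt (φ := φ) (u := u) (q := q) (by rwa [hgr]) hsm
      (by rwa [hgr, hp])
    refine ⟨v, hv, ?_⟩
    have hV : ∀ y, fderiv ℝ v (φ.newIndep u q) y = V y := by
      intro y
      have h1 := hv.fderiv_target (N.symm y)
      rw [hgr, hp, hNN] at h1
      exact h1
    have hjet : gradJet v (φ.newIndep u q) = γ := by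
      refine Prod.ext ?_ (funext fun a => hV _)
      have h1 : v (φ.newIndep u q) = φ.Ψ (graphMap u q) := hv.eq_near.self_of_nhds
      have h2 : φ.newIndep u q = φ.base (graphMap u q) := rfl
      simp only [gradJet]
      rw [h1, h2, hgr]
      rfl
    have htr : ∑ b, pdX b (pdX b v) (φ.newIndep u q)
        = S + l0 (∑ b, B (N.symm (axisX b)) (N.symm (axisX b))) := by
      rw [map_sum, ← Finset.sum_add_distrib]
      refine Finset.sum_congr rfl fun b _ => ?_
      rw [← hv.pdX_pdX_target]
      have h1 := hv.fderiv_fderiv_target (N.symm (axisX b)) (N.symm (axisX b))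
      rw [hgr, hp, hBB, hNN, hV, map_add] at h1
      have h2 : ∀ w, l0 w = fderiv ℝ φ.Ψ z (0, 0, w) - V (fderiv ℝ φ.base z (0, 0, w)) :=
        fun w => rfl
      rw [h2]
      simp only [graphCLM_apply]
      linear_combination h1
    have hpt : pdT v (φ.newIndep u q) = V (1, 0) := hV _
    unfold ClassN.HoldsAt
    rw [hjet, htr, hpt]
    have e : ∀ w, (L'.G γ • l0) w = L'.G γ * l0 w := fun w => rfl
    rw [e]
    constructor <;> intro h <;> linear_combination h

/-- Admissibility forces the total Jacobian to be conformal on spatial vectors at each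
first-order jet where the prolongation is defined. -/
theorem IsAdmissible.totalJacobian_conformal (hn : 0 < n) (h : φ.IsAdmissible L L')
    (hz : z ∈ φ.dom) (p : Indep n →L[ℝ] ℂ) (hdet : (φ.totalJacobian z p).det ≠ 0) :
    (∀ a, (φ.totalJacobian z p (axisX a)).1 = 0) ∧ ∃ c : ℝ, 0 < c ∧ ∀ i j,
      ∑ a, (φ.totalJacobian z p (axisX a)).2 i * (φ.totalJacobian z p (axisX a)).2 j
        = if i = j then c else 0 := by
  obtain ⟨k, l, hl, hB⟩ := exists_affine_condition L' hz p hdet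
  set N := (φ.totalJacobian z p).toContinuousLinearEquivOfDetNeZero hdet with hN
  set q : Indep n := (z.1, z.2.1) with hq
  let γ : GradVars n := (z, fun a => p (axisX a))
  have hG : L.G γ ≠ 0 := L.G_ne_zero _ hz _
  have hL : ∀ B : Indep n →L[ℝ] Indep n →L[ℝ] ℂ, (∀ a b, B a b = B b a) →
      (L.HoldsAt (quadraticAt q z.2.2 p B) q ↔ Complex.I * p (1, 0)
        + L.G γ * ∑ a, B (axisX a) (axisX a) + L.F γ = 0) := by
    intro B hB
    have h1 : fderiv ℝ (quadraticAt q z.2.2 p B) q = p := fderiv_quadraticAt_self q z.2.2 p hB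
    have h2 : ∀ a, pdX a (pdX a (quadraticAt q z.2.2 p B)) q = B (axisX a) (axisX a) := by
      intro a
      have h3 := (contDiff_quadraticAt q z.2.2 p B).contDiffAt.fderiv_fderiv_apply
        (x := q) (axisX a) (axisX a)
      rw [fderiv_fderiv_quadraticAt q z.2.2 p hB] at h3
      exact h3
    have h4 : gradJet (quadraticAt q z.2.2 p B) q = γ := by
      refine Prod.ext ?_ (funext fun a => ?_)
      · simp [gradJet, hq, γ]
      · simp only [gradJet, pdX, h1]
        rfl
    unfold ClassN.HoldsAt
    simp only [h2, h4, pdT, h1]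
  have hiff : ∀ B : Indep n →L[ℝ] Indep n →L[ℝ] ℂ, (∀ a b, B a b = B b a) →
      (Complex.I * p (1, 0) + L.G γ * ∑ a, B (axisX a) (axisX a) + L.F γ = 0 ↔
        k + l (∑ b, B (N.symm (axisX b)) (N.symm (axisX b))) = 0) := by
    intro B hBs
    obtain ⟨v, hv, hvi⟩ := hB B hBs
    rw [← hL B hBs, ← hvi]
    exact h _ _ _ hv
  let i0 : Fin n := ⟨0, hn⟩
  -- A Hessian solving the old equation. Adding a form of zero spatial trace preserves that
  -- equation, hence the new one; subtracting the two new conditions isolates the pulled-back trace.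
  let B0 := formProd (formX i0) (formX i0) (-(Complex.I * p (1, 0) + L.F γ) / L.G γ)
  have hB0s : ∀ a b, B0 a b = B0 b a := by intro a b; simp [B0, mul_comm]
  have hB0 : ∑ a, B0 (axisX a) (axisX a) = -(Complex.I * p (1, 0) + L.F γ) / L.G γ := by
    rw [Finset.sum_eq_single i0]
    · simp [B0, axisX]
    · intro b _ hb
      simp [B0, axisX, hb.symm]
    · simp
  have hk0 := (hiff B0 hB0s).1 (by rw [hB0]; field_simp; ring)
  have hNe : ∀ a, N a = φ.totalJacobian z p a := fun a =>
    (φ.totalJacobian z p).toContinuousLinearEquivOfDetNeZero_apply hdet a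
  simp only [← hNe]
  refine conformal_of_trace_vanishing hn N fun B hBs htr => ?_
  have hk1 := (hiff (B0 + B) (by intro a b; simp [hB0s a b, hBs a b])).1 (by
    simp only [add_apply, Finset.sum_add_distrib, htr, hB0]
    field_simp
    ring)
  simp only [add_apply, Finset.sum_add_distrib, map_add] at hk1
  apply hl
  rw [map_zero, map_sum]
  simp only [map_sum] at hk0 hk1
  linear_combination hk1 - hk0

theorem totalJacobian_add (p δ : Indep n →L[ℝ] ℂ) (a : Indep n) :
    φ.totalJacobian z (p + δ) a
      = φ.totalJacobian z p a + fderiv ℝ φ.base z (0, 0, δ a) := by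
  simp only [totalJacobian_apply, ← map_add]
  simp

/-- The Jacobian is affine in the first-order jet. Continuity of its determinant keeps small
perturbations of a nondegenerate jet nondegenerate. -/
theorem continuous_totalJacobian_det (φ : PointTransformation n) (z : Vars n)
    (p δ : Indep n →L[ℝ] ℂ) :
    Continuous fun s : ℝ => (φ.totalJacobian z (p + s • δ)).det := by
  have h : (fun s : ℝ => φ.totalJacobian z (p + s • δ)) = fun s =>
      φ.totalJacobian z p + s • ((fderiv ℝ φ.base z).comp ((fibreCLM n).comp δ)) := by
    funext s
    refine ContinuousLinearMap.ext fun a => ?_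
    rw [totalJacobian_add, add_apply]
    congr 1
    have h1 : ((0, 0, (s • δ) a) : Vars n) = s • (0, 0, δ a) := by simp
    rw [h1, map_smul]
    rfl
  exact ContinuousLinearMap.continuous_det.comp
    (g := fun A : Indep n →L[ℝ] Indep n => A.det)
    (by rw [h]; fun_prop)

/-- An admissible transformation is fibre-preserving. -/
theorem IsAdmissible.fderiv_base_fibre (hn : 2 ≤ n) (h : φ.IsAdmissible L L')
    (hz : z ∈ φ.dom) (w : ℂ) : fderiv ℝ φ.base z (0, 0, w) = 0 := by
  obtain ⟨p, hp⟩ := exists_totalJacobian_det_ne_zero hz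
  let a0 : Fin n := ⟨0, by omega⟩
  -- This perturbation changes only the column of the total Jacobian along `x_{a0}`, by a multiple
  -- of `ξ`.
  let δ : Indep n →L[ℝ] ℂ := (formX a0).smulRight w
  have hδ : ∀ a, δ (axisX a) = if a = a0 then w else 0 := by
    intro a
    by_cases ha : a = a0
    · subst ha; simp [δ, axisX]
    · simp [δ, axisX, ha, Ne.symm ha]
  have hev : ∀ᶠ s : ℝ in nhds 0, (φ.totalJacobian z (p + s • δ)).det ≠ 0 := by
    refine (continuous_totalJacobian_det φ z p δ).continuousAt.eventually_ne ?_
    have h0 : p + (0 : ℝ) • δ = p := ContinuousLinearMap.ext fun a => by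
      rw [add_apply, smul_apply, zero_smul, add_zero]
    rwa [h0]
  have hev2 : ∀ᶠ s : ℝ in nhds 0, (φ.totalJacobian z (p + (-s) • δ)).det ≠ 0 := by
    have : Filter.Tendsto (fun s : ℝ => -s) (nhds 0) (nhds 0) := by
      simpa using (continuous_neg (G := ℝ)).tendsto 0
    exact this.eventually hev
  obtain ⟨s, ⟨hs1, hs2⟩, hs0⟩ : ∃ s : ℝ, ((φ.totalJacobian z (p + s • δ)).det ≠ 0 ∧
      (φ.totalJacobian z (p + (-s) • δ)).det ≠ 0) ∧ s ≠ 0 := by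
    have := (hev.and hev2).filter_mono (nhdsWithin_le_nhds (s := {0}ᶜ))
    exact (this.and self_mem_nhdsWithin).exists
  set ξ := fderiv ℝ φ.base z (0, 0, w) with hξ
  have hJ : ∀ (r : ℝ) (a : Fin n), φ.totalJacobian z (p + r • δ) (axisX a)
      = φ.totalJacobian z p (axisX a) + (if a = a0 then r else 0) • ξ := by
    intro r a
    rw [totalJacobian_add, smul_apply, hδ]
    congr 1
    split_ifs
    · have h1 : ((0, 0, r • w) : Vars n) = r • (0, 0, w) := by simp
      rw [h1, map_smul]
    · rw [smul_zero, zero_smul]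
      exact map_zero _
  obtain ⟨hT0, c0, -, hc0⟩ := h.totalJacobian_conformal (by omega) hz p hp
  obtain ⟨hT1, c1, -, hc1⟩ := h.totalJacobian_conformal (by omega) hz _ hs1
  obtain ⟨hT2, c2, -, hc2⟩ := h.totalJacobian_conformal (by omega) hz _ hs2
  -- The second difference of the conformality relations at `p + s δ`, `p`, `p - s δ`: terms linear
  -- in `s` cancel and only `ξ ξᵀ` remains.
  have hq : ∀ i j, 2 * s ^ 2 * (ξ.2 i * ξ.2 j) = if i = j then c1 + c2 - 2 * c0 else 0 := by
    intro i j
    have h0 := hc0 i j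
    have h1 := hc1 i j
    have h2 := hc2 i j
    simp only [hJ] at h1 h2
    have hsum : 2 * s ^ 2 * (ξ.2 i * ξ.2 j) = ∑ a : Fin n, if a = a0 then
        2 * s ^ 2 * (ξ.2 i * ξ.2 j) else 0 := by simp
    have : (if i = j then c1 + c2 - 2 * c0 else 0)
        = (if i = j then c1 else 0) + (if i = j then c2 else 0)
          - 2 * (if i = j then c0 else 0) := by
      split_ifs <;> ring
    rw [this, ← h0, ← h1, ← h2, hsum, Finset.mul_sum, ← Finset.sum_add_distrib,
      ← Finset.sum_sub_distrib]
    refine Finset.sum_congr rfl fun a _ => ?_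
    simp only [Prod.snd_add, Prod.smul_snd, Pi.add_apply, Pi.smul_apply, smul_eq_mul]
    split_ifs <;> ring
  have hs2' : 2 * s ^ 2 ≠ 0 := by positivity
  refine Prod.ext ?_ (funext fun b => ?_)
  · have h1 := hT1 a0
    rw [hJ, Prod.fst_add, hT0, if_pos rfl, zero_add, Prod.smul_fst, smul_eq_mul] at h1
    exact (mul_eq_zero.1 h1).resolve_left hs0
  · have : Nontrivial (Fin n) := Fin.nontrivial_iff_two_le.2 hn
    obtain ⟨c, hcb⟩ := exists_ne b
    have h1 := hq b b
    have h2 := hq c c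
    have h3 := hq b c
    rw [if_pos rfl] at h1 h2
    rw [if_neg hcb.symm] at h3
    have h4 : ξ.2 b * ξ.2 b = ξ.2 c * ξ.2 c := mul_left_cancel₀ hs2' (h1.trans h2.symm)
    have h5 : ξ.2 b * ξ.2 c = 0 := (mul_eq_zero.1 h3).resolve_left hs2'
    rcases mul_eq_zero.1 h5 with h6 | h6
    · exact h6
    · rw [h6, mul_zero] at h4
      exact mul_self_eq_zero.1 h4

end PointTransformation

/-! ### Necessity: the conformal system and the arbitrary elements -/

namespace PointTransformation

variable {n : ℕ} {φ : PointTransformation n} {z : Vars n} {L : ClassN n φ.dom}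
  {L' : ClassN n φ.image} {H : Indep n → ℝ}

namespace IsAdmissible

theorem fderiv_T_fibre (hn : 2 ≤ n) (h : φ.IsAdmissible L L') (hz : z ∈ φ.dom) (w : ℂ) :
    fderiv ℝ φ.T z (0, 0, w) = 0 := by
  have h1 := h.fderiv_base_fibre hn hz w
  rw [fderiv_base hz] at h1
  exact congrArg Prod.fst h1

theorem fderiv_X_fibre (hn : 2 ≤ n) (h : φ.IsAdmissible L L') (hz : z ∈ φ.dom) (b : Fin n)
    (w : ℂ) : fderiv ℝ (fun w => φ.X w b) z (0, 0, w) = 0 := by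
  have h1 := h.fderiv_base_fibre hn hz w
  rw [fderiv_base hz] at h1
  rw [fderiv_X_apply hz]
  exact congrFun (congrArg Prod.snd h1) b

/-- Once fibre derivatives of `(T, X)` vanish, the total Jacobian is the same for all first-order
jets, and one of them is nondegenerate. -/
theorem totalJacobian_det_ne_zero (hn : 2 ≤ n) (h : φ.IsAdmissible L L') (hz : z ∈ φ.dom)
    (p : Indep n →L[ℝ] ℂ) : (φ.totalJacobian z p).det ≠ 0 := by
  obtain ⟨p₀, hp₀⟩ := exists_totalJacobian_det_ne_zero hz
  have h1 : ∀ p, φ.totalJacobian z p = φ.totalJacobian z 0 := by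
    intro p
    refine ContinuousLinearMap.ext fun a => ?_
    have h2 := totalJacobian_add (φ := φ) (z := z) 0 p a
    rwa [h.fderiv_base_fibre hn hz, zero_add, add_zero] at h2
  rwa [h1, ← h1 p₀]

theorem totalJacobian_zero_axisX (hz : z ∈ φ.dom) (a : Fin n) :
    φ.totalJacobian z 0 (axisX a) = (vdX a φ.T z, fun b => vdX a (fun w => φ.X w b) z) := by
  rw [totalJacobian_apply, fderiv_base hz]
  exact Prod.ext rfl (funext fun b => (fderiv_X_apply hz b _).symm)

theorem vdX_T (hn : 2 ≤ n) (h : φ.IsAdmissible L L') (hz : z ∈ φ.dom) (a : Fin n) :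
    vdX a φ.T z = 0 := by
  have h1 := (h.totalJacobian_conformal (by omega) hz 0 (h.totalJacobian_det_ne_zero hn hz 0)).1 a
  rwa [totalJacobian_zero_axisX hz] at h1

theorem vdX_X (hn : 2 ≤ n) (h : φ.IsAdmissible L L') (hz : z ∈ φ.dom) :
    ∃ c : ℝ, 0 < c ∧ ∀ i j, ∑ a, vdX a (fun w => φ.X w i) z * vdX a (fun w => φ.X w j) z
      = if i = j then c else 0 := by
  have h1 := (h.totalJacobian_conformal (by omega) hz 0 (h.totalJacobian_det_ne_zero hn hz 0)).2
  simpa only [totalJacobian_zero_axisX hz] using h1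

/-- Otherwise every partial derivative of `T` would vanish, against the surjectivity of the
derivative of `(T, X)`. -/
theorem vdT_T_ne_zero (hn : 2 ≤ n) (h : φ.IsAdmissible L L') (hz : z ∈ φ.dom) :
    vdT φ.T z ≠ 0 := by
  intro h0
  obtain ⟨a, ha⟩ := exists_fderiv_eq hz (1, 0)
  have h1 : a = a.1 • ((1, 0, 0) : Vars n) + ∑ b, a.2.1 b • varsAxisX b + (0, 0, a.2.2) := by
    refine Prod.ext ?_ (Prod.ext (funext fun i => ?_) ?_)
    · simp [Prod.fst_sum, varsAxisX]
    · simp [Prod.fst_sum, Prod.snd_sum, varsAxisX, Finset.sum_apply, Pi.single_apply]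
    · simp [Prod.snd_sum, varsAxisX]
  have h2 : fderiv ℝ φ.T z a = 0 := by
    have h3 : ∀ b, fderiv ℝ φ.T z (varsAxisX b) = 0 := fun b => h.vdX_T hn hz b
    have h4 : fderiv ℝ φ.T z (1, 0, 0) = 0 := h0
    rw [h1, map_add, map_add, map_sum, h.fderiv_T_fibre hn hz, map_smul, h4]
    simp [h3]
  rw [fderiv_base hz, h2] at ha
  exact zero_ne_one (congrArg Prod.fst ha)

/-- The Jacobian matrix of `X` does not depend on `ψ`. -/
theorem vdX_X_eq_of_fibre (hn : 2 ≤ n) (h : φ.IsAdmissible L L') {t : ℝ} {x : Fin n → ℝ}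
    (hfib : IsPreconnected {w : ℂ | (t, x, w) ∈ φ.dom}) {w₁ w₂ : ℂ}
    (h₁ : (t, x, w₁) ∈ φ.dom) (h₂ : (t, x, w₂) ∈ φ.dom) (a b : Fin n) :
    vdX a (fun w => φ.X w b) (t, x, w₁) = vdX a (fun w => φ.X w b) (t, x, w₂) := by
  have hd : ∀ w, (t, x, w) ∈ φ.dom → HasFDerivAt
      (fun w : ℂ => vdX a (fun w => φ.X w b) (t, x, w)) (0 : ℂ →L[ℝ] ℝ) w := by
    intro w hw
    have hX := contDiffAt_X_apply hw b
    have h1 : DifferentiableAt ℝ (vdX a fun w => φ.X w b) (t, x, w) :=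
      hX.fderiv_of_smooth.differentiableAt_of_smooth.clm_apply (differentiableAt_const _)
    have h2 : HasFDerivAt (fun w : ℂ => ((t, x, w) : Vars n)) (fibreCLM n) w := by
      have h3 := (fibreCLM n).hasFDerivAt (x := w) |>.const_add ((t, x, 0) : Vars n)
      refine h3.congr_of_eventuallyEq (Filter.Eventually.of_forall fun w => ?_)
      simp
    have h4 := HasFDerivAt.comp w (f := fun w : ℂ => ((t, x, w) : Vars n)) h1.hasFDerivAt h2
    refine h4.congr_fderiv (ContinuousLinearMap.ext fun y => ?_)
    have h5 : fderiv ℝ (vdX a fun w => φ.X w b) (t, x, w) (0, 0, y)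
        = fderiv ℝ (fderiv ℝ fun w => φ.X w b) (t, x, w) (0, 0, y) (varsAxisX a) :=
      hX.fderiv_fderiv_apply _ _
    -- The fibre derivative of `X` vanishes near the point, so by symmetry the fibre derivative of
    -- `X_a` vanishes; the open connected fibre then makes `X_a` constant.
    have hev : (fun z => fderiv ℝ (fun w => φ.X w b) z (0, 0, y))
        =ᶠ[nhds (t, x, w)] fun _ => 0 := by
      filter_upwards [φ.isOpen_dom.mem_nhds hw] with z hz
      exact h.fderiv_X_fibre hn hz b y
    change fderiv ℝ (vdX a fun w => φ.X w b) (t, x, w) (0, 0, y) = 0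
    rw [h5, hX.fderiv_fderiv_comm, ← hX.fderiv_fderiv_apply, hev.fderiv_eq]
    simp
  have hopen : IsOpen {w : ℂ | (t, x, w) ∈ φ.dom} :=
    φ.isOpen_dom.preimage (f := fun w : ℂ => ((t, x, w) : Vars n)) (by fun_prop)
  exact hopen.is_const_of_fderiv_eq_zero (𝕜 := ℝ) hfib
    (fun w hw => (hd w hw).differentiableAt.differentiableWithinAt)
    (fun w hw => (hd w hw).fderiv) h₁ h₂

theorem exists_isConformalWith (hn : 2 ≤ n) (h : φ.IsAdmissible L L')
    (hfib : ∀ (t : ℝ) (x : Fin n → ℝ), IsPreconnected {w : ℂ | (t, x, w) ∈ φ.dom}) :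
    ∃ H, φ.IsConformalWith H := by
  let i0 : Fin n := ⟨0, by omega⟩
  let f : Vars n → ℝ := fun z => ∑ a, vdX a (fun w => φ.X w i0) z * vdX a (fun w => φ.X w i0) z
  -- `f` is constant on fibres, so it descends to `(t, x)`. Off the projection of the domain the
  -- value is immaterial. Smoothness is checked locally by freezing `ψ`.
  have hex : ∀ q : Indep n, ∃ y : ℝ, ∀ w, (q.1, q.2, w) ∈ φ.dom → y = f (q.1, q.2, w) := by
    intro q
    by_cases hq : ∃ w, (q.1, q.2, w) ∈ φ.dom
    · obtain ⟨w₀, hw₀⟩ := hq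
      refine ⟨f (q.1, q.2, w₀), fun w hw => ?_⟩
      simp only [f, h.vdX_X_eq_of_fibre hn (hfib q.1 q.2) hw₀ hw]
    · exact ⟨0, fun w hw => (hq ⟨w, hw⟩).elim⟩
  choose H hH using hex
  have hHf : ∀ z ∈ φ.dom, H (z.1, z.2.1) = f z := fun z hz => hH (z.1, z.2.1) z.2.2 hz
  have hfc : ∀ z ∈ φ.dom, 0 < f z ∧
      ∀ i j, ∑ a, vdX a (fun w => φ.X w i) z * vdX a (fun w => φ.X w j) z
        = if i = j then f z else 0 := by
    intro z hz
    obtain ⟨c, hc, hij⟩ := h.vdX_X hn hz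
    have hcf : f z = c := by simpa using hij i0 i0
    rw [hcf]
    exact ⟨hc, hij⟩
  refine ⟨H, ?_, ?_, ?_, ?_, fun z hz a => h.vdX_T hn hz a, fun z hz => h.vdT_T_ne_zero hn hz,
    ?_, ?_, ?_⟩
  · rintro _ ⟨z, hz, rfl⟩
    refine ContDiffAt.contDiffWithinAt ?_
    have hι : ContDiff ℝ ∞ fun q : Indep n => ((q.1, q.2, z.2.2) : Vars n) := by fun_prop
    have hf : ContDiffAt ℝ ∞ f z := by
      have h1 : ∀ a, ContDiffAt ℝ ∞ (vdX a fun w => φ.X w i0) z := fun a =>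
        (contDiffAt_X_apply hz i0).fderiv_of_smooth.clm_apply contDiffAt_const
      exact ContDiffAt.sum fun a _ => (h1 a).mul (h1 a)
    have h2 : ContDiffAt ℝ ∞ (fun q : Indep n => f (q.1, q.2, z.2.2)) (z.1, z.2.1) :=
      ContDiffAt.comp (z.1, z.2.1) (f := fun q : Indep n => ((q.1, q.2, z.2.2) : Vars n))
        hf hι.contDiffAt
    refine h2.congr_of_eventuallyEq ?_
    filter_upwards [hι.continuous.continuousAt.preimage_mem_nhds
      (φ.isOpen_dom.mem_nhds (show ((z.1, z.2.1).1, (z.1, z.2.1).2, z.2.2) ∈ φ.dom from hz))]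
      with q hq
    exact hH q _ hq
  · rintro _ ⟨z, hz, rfl⟩
    rw [hHf z hz]
    exact (hfc z hz).1
  · intro z hz
    simp [vdPsi, fderiv_ofReal_comp (contDiffAt_T hz).differentiableAt_of_smooth,
      h.fderiv_T_fibre hn hz]
  · intro z hz
    simp [vdPsiBar, fderiv_ofReal_comp (contDiffAt_T hz).differentiableAt_of_smooth,
      h.fderiv_T_fibre hn hz]
  · intro z hz b
    simp [vdPsi, fderiv_ofReal_comp (contDiffAt_X_apply hz b).differentiableAt_of_smooth,
      h.fderiv_X_fibre hn hz]
  · intro z hz b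
    simp [vdPsiBar, fderiv_ofReal_comp (contDiffAt_X_apply hz b).differentiableAt_of_smooth,
      h.fderiv_X_fibre hn hz]
  · intro z hz b c
    rw [hHf z hz]
    exact (hfc z hz).2 b c

/-- The condition that admissibility puts on `ψ_t = τ` and `ψ_aa = σ` at a given point
`(t, x, ψ, ∇ψ)`. -/
theorem equation_iff (hn : 2 ≤ n) (h : φ.IsAdmissible L L') (hc : φ.IsConformalWith H)
    (hz : z ∈ φ.dom) (p : Fin n → ℂ) (τ σ : ℂ) :
    Complex.I * τ + L.G (z, p) * σ + L.F (z, p) = 0 ↔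
      vdPsi φ.Ψ z * (Complex.I * τ
          + L'.G (φ.newGradVars H z p) * vdT φ.T z / H (z.1, z.2.1) * σ + L.F (z, p))
        - vdPsiBar φ.Ψ z * conj (Complex.I * τ
          + -conj (L'.G (φ.newGradVars H z p) * vdT φ.T z / H (z.1, z.2.1)) * σ + L.F (z, p))
        + vdT φ.T z * (L'.F (φ.newGradVars H z p)
          - φ.newF H L.F (L'.G (φ.newGradVars H z p)) z p) = 0 := by
  let i0 : Fin n := ⟨0, by omega⟩
  set q : Indep n := (z.1, z.2.1) with hq
  -- The polynomial jet has `ψ_t = τ`, `∇ψ = p`, and its Laplacian `σ` concentrated on one axis.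
  let P : Indep n →L[ℝ] ℂ := (formT n).smulRight τ + ∑ a, (formX a).smulRight (p a)
  let B := formProd (formX i0) (formX i0) σ
  have hB : ∀ a b, B a b = B b a := by intro a b; simp [B, mul_comm]
  set u := quadraticAt q z.2.2 P B with hu
  have hgr : graphMap u q = z := by simp [graphMap, hu, hq]
  have hsm : ContDiffAt ℝ ∞ u q := (contDiff_quadraticAt q z.2.2 P B).contDiffAt
  have hP : fderiv ℝ u q = P := fderiv_quadraticAt_self q z.2.2 P hB
  have hpT : pdT u q = τ := by
    rw [pdT, hP]
    simp [P]
  have hpX : (fun a => pdX a u q) = p := by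
    funext a
    rw [pdX, hP]
    simp [P, Pi.single_apply]
  have hlap : ∑ a, pdX a (pdX a u) q = σ := by
    have h1 : ∀ a, pdX a (pdX a u) q = B (axisX a) (axisX a) := by
      intro a
      have h3 := hsm.fderiv_fderiv_apply (axisX a) (axisX a)
      rw [fderiv_fderiv_quadraticAt q z.2.2 P hB] at h3
      exact h3
    simp only [h1]
    rw [Finset.sum_eq_single i0]
    · simp [B, axisX]
    · intro b _ hb
      simp [B, axisX, hb.symm]
    · simp
  obtain ⟨v, hv⟩ := exists_carriesAt (φ := φ) (u := u) (q := q) (by rwa [hgr]) hsm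
    (by rw [hgr]; exact h.totalJacobian_det_ne_zero hn hz _)
  have hjet : gradJet u q = (z, p) := by
    change (graphMap u q, fun a => pdX a u q) = _
    rw [hgr, hpX]
  have h1 := h u q v hv
  unfold ClassN.HoldsAt at h1
  rw [hv.gradJet_target hc, hpT, hlap, hjet, hgr, hpX] at h1
  have h2 := hv.transformed_equation hc L.F (L'.G (φ.newGradVars H z p))
    (L'.F (φ.newGradVars H z p))
  rw [hgr, hpX, hpT, hlap, hjet] at h2
  have hT : ((vdT φ.T z : ℝ) : ℂ) ≠ 0 := by exact_mod_cast hc.T_t _ hz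
  rw [h1, ← h2, mul_eq_zero, or_iff_right hT]

/-- The necessity of the conditions on the arbitrary elements. -/
theorem arbitrary_elements (hn : 2 ≤ n) (h : φ.IsAdmissible L L') (hc : φ.IsConformalWith H)
    (hz : z ∈ φ.dom) (p : Fin n → ℂ) :
    (conj (L.G (z, p)) ≠ -L.G (z, p) → vdPsi φ.Ψ z * vdPsiBar φ.Ψ z = 0) ∧
    (vdPsi φ.Ψ z ≠ 0 → L'.G (φ.newGradVars H z p)
      = ((H (z.1, z.2.1) / vdT φ.T z : ℝ) : ℂ) * L.G (z, p)) ∧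
    (vdPsiBar φ.Ψ z ≠ 0 → L'.G (φ.newGradVars H z p)
      = ((H (z.1, z.2.1) / vdT φ.T z : ℝ) : ℂ) * -conj (L.G (z, p))) ∧
    L'.F (φ.newGradVars H z p) = φ.newF H L.F (L'.G (φ.newGradVars H z p)) z p := by
  have hT : ((vdT φ.T z : ℝ) : ℂ) ≠ 0 := by exact_mod_cast hc.T_t _ hz
  have hH : ((H (z.1, z.2.1) : ℝ) : ℂ) ≠ 0 := by
    exact_mod_cast (hc.H_pos _ (indep_mem_indepDom hz)).ne'
  set g := L'.G (φ.newGradVars H z p) with hg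
  set g' : ℂ := g * vdT φ.T z / H (z.1, z.2.1) with hg'
  have hgg : g = ((H (z.1, z.2.1) / vdT φ.T z : ℝ) : ℂ) * g' := by
    rw [hg']
    push_cast
    field_simp
  set R : ℂ := vdT φ.T z * (L'.F (φ.newGradVars H z p) - φ.newF H L.F g z p) with hR
  -- Choosing `τ = i (G σ + F)` solves the old equation for every `σ`, leaving a real-affine
  -- identity in `σ`. The values 0, 1 and `i` separate its three coefficients.
  have key : ∀ σ : ℂ, vdPsi φ.Ψ z * (g' - L.G (z, p)) * σ
      + vdPsiBar φ.Ψ z * (g' + conj (L.G (z, p))) * conj σ + R = 0 := by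
    intro σ
    have h1 := (h.equation_iff hn hc hz p (Complex.I * (L.G (z, p) * σ + L.F (z, p))) σ).1
      (by linear_combination (L.G (z, p) * σ + L.F (z, p)) * Complex.I_mul_I)
    rw [← hg, ← hg', ← hR] at h1
    simp only [← mul_assoc, Complex.I_mul_I] at h1
    simp only [map_add, map_mul, map_neg, Complex.conj_conj, map_one] at h1
    linear_combination h1
  have hR0 : R = 0 := by simpa using key 0
  have k1 := key 1
  have kI := key Complex.I
  rw [hR0, add_zero] at k1 kI
  rw [Complex.conj_I] at kI
  rw [map_one] at k1
  have e1 : vdPsi φ.Ψ z * (g' - L.G (z, p)) = 0 := by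
    linear_combination k1 / 2 - Complex.I / 2 * kI
      + (vdPsi φ.Ψ z * (g' - L.G (z, p)) - vdPsiBar φ.Ψ z * (g' + conj (L.G (z, p)))) / 2
        * Complex.I_mul_I
  have e2 : vdPsiBar φ.Ψ z * (g' + conj (L.G (z, p))) = 0 := by
    linear_combination k1 - e1
  have f1 : vdPsi φ.Ψ z ≠ 0 → g' = L.G (z, p) := fun h0 =>
    sub_eq_zero.1 ((mul_eq_zero.1 e1).resolve_left h0)
  have f2 : vdPsiBar φ.Ψ z ≠ 0 → g' = -conj (L.G (z, p)) := fun h0 =>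
    eq_neg_of_add_eq_zero_left ((mul_eq_zero.1 e2).resolve_left h0)
  refine ⟨fun hne => ?_, fun h0 => ?_, fun h0 => ?_, ?_⟩
  · by_contra h0
    rw [mul_eq_zero, not_or] at h0
    apply hne
    linear_combination f2 h0.2 - f1 h0.1
  · rw [hgg, f1 h0]
  · rw [hgg, f2 h0]
  · exact sub_eq_zero.1 ((mul_eq_zero.1 hR0).resolve_left hT)

end IsAdmissible

end PointTransformation

theorem mainTheorem1 (n : ℕ) (hn : 2 ≤ n) (φ : PointTransformation n)
    (hfib : ∀ (t : ℝ) (x : Fin n → ℝ), IsPreconnected {w : ℂ | (t, x, w) ∈ φ.dom})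
    (L : ClassN n φ.dom) (L' : ClassN n φ.image) :
    φ.IsAdmissible L L' ↔
      ∃ H : Indep n → ℝ, φ.IsConformalWith H ∧
        ∀ z ∈ φ.dom, ∀ p : Fin n → ℂ,
          (conj (L.G (z, p)) ≠ -L.G (z, p) → vdPsi φ.Ψ z * vdPsiBar φ.Ψ z = 0) ∧
          (vdPsi φ.Ψ z ≠ 0 →
            L'.G (φ.newGradVars H z p)
              = ((H (z.1, z.2.1) / vdT φ.T z : ℝ) : ℂ) * L.G (z, p)) ∧
          (vdPsiBar φ.Ψ z ≠ 0 →
            L'.G (φ.newGradVars H z p)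
              = ((H (z.1, z.2.1) / vdT φ.T z : ℝ) : ℂ) * -conj (L.G (z, p))) ∧
          L'.F (φ.newGradVars H z p)
            = φ.newF H L.F (L'.G (φ.newGradVars H z p)) z p := by
  constructor
  · intro h
    obtain ⟨H, hc⟩ := h.exists_isConformalWith hn hfib
    exact ⟨H, hc, fun z hz p => h.arbitrary_elements hn hc hz p⟩
  · rintro ⟨H, hc, h⟩
    -- The clause on `Ψ_ψ Ψ_{ψ*}` is implied by the two formulas for `G̃`: if both derivatives are
    -- nonzero, equating them gives `G* = -G`, since `H / T_t ≠ 0`.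
    exact PointTransformation.isAdmissible_of_conformal hc fun z hz p => (h z hz p).2
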